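/- Consider the binary erasure channel $Y_k=X_kE_k$, $k\in\mathbb Z$, where the input $X=(X_k)_{k\in\mathbb Z}$ is a stationary process with values in $\{1,2\}$ and the erasure process $E=(E_k)_{k\in\mathbb Z}$ is independent of $X$ and i.i.d. with $P(E_k=0)=\varepsilon=1-P(E_k=1)$, $\varepsilon\in[0,1]$. Let $\mathcal S_0$ be the $(1,\infty)$-RLL constraint, i.e. the set of all finite words over $\{1,2\}$ that do not contain $22$ as a contiguous subword; $X$ is supported on $\mathcal S_0$ if every finite word that $X$ takes with positive probability lies in $\mathcal S_0$. Let $$I(X;Y)=\lim_{n\to\infty}\frac1n I(X_1^n;Y_1^n)$$ be the mutual information rate (natural logarithms), let $C(\mathcal S_0,\varepsilon)$ be the supremum of $I(X;Y)$ over all stationary $X$ supported on $\mathcal S_0$, and for $n\ge1$ let $C^{(n)}(\mathcal S_0,\varepsilon)$ be the supremum of $I(X;Y)$ over all stationary $n$-th order Markov chains $X$ supported on $\mathcal S_0$. (The limit exists for each such $X$, and the suprema are over nonempty bounded sets.) Let $\lambda=(1+\sqrt5)/2$. Then, as $\varepsilon\to0$, $$C(\mathcal S_0,\varepsilon)=\log\lambda-\frac{2\log2}{1+\lambda^2}\,\varepsilon+O(\varepsilon^2),$$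 and for every $n\ge1$, $$C^{(n)}(\mathcal S_0,\varepsilon)=\log\lambda-\frac{2\log2}{1+\lambda^2}\,\varepsilon+O(\varepsilon^2),$$ where the constant in $O(\varepsilon^2)$ may depend on $n$. -/

import Mathlib

open MeasureTheory Filter Topology Asymptotics

namespace ErasureChannel

noncomputable section

/-- The input alphabet `{1, …, K}`, as the nonzero elements of the output alphabet `{0, …, K}`. -/
abbrev Input (K : ℕ) : Type := {k : Fin (K + 1) // k ≠ 0}

/-- The output alphabet `{0, 1, …, K}`; the letter `0` is an erasure. -/
abbrev Output (K : ℕ) : Type := Fin (K + 1)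

/-- The channel output `x · e` for the input letter `x` and `e ∈ {0, 1}`. -/
def output {K : ℕ} (x : Input K) (e : Fin 2) : Output K := if e = 0 then 0 else x.1

/-- The word `x_i x_{i+1} … x_{i+n-1}` of a two-sided sequence. -/
def word {A : Type*} (x : ℤ → A) (i : ℤ) (n : ℕ) : List A :=
  List.ofFn fun k : Fin n => x (i + (k : ℕ))

/-- The words over `A` that contain no word of `F` as a contiguous subsequence. -/
def finiteTypeConstraint {A : Type*} (F : Set (List A)) : Set (List A) :=
  {w | ∀ f ∈ F, ¬ f <:+: w}

/-- The `(1, ∞)`-RLL constraint over `{1, 2}`: the word `22` is forbidden. -/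
def rll : Set (List (Input 2)) :=
  finiteTypeConstraint {[⟨2, by decide⟩, ⟨2, by decide⟩]}

section Law

/-! A process with time set `ℤ` is given by its law, a probability measure `P` on `ℤ → A`. -/

variable {A : Type*} [MeasurableSpace A]

/-- Stationarity: the law is invariant under the shift. -/
def IsStationary (P : Measure (ℤ → A)) : Prop :=
  MeasurePreserving (fun (x : ℤ → A) (k : ℤ) => x (k + 1)) P P

/-- The probability that the process spells the word `w` from time `i` on. -/
def wordProb (P : Measure (ℤ → A)) (i : ℤ) (w : List A) : ℝ :=
  P.real {x | word x i w.length = w}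

/-- The set of the words that occur with positive probability. -/
def words (P : Measure (ℤ → A)) : Set (List A) :=
  {w | ∃ i : ℤ, 0 < wordProb P i w}

/-- The process is an `m`-th order Markov chain: given the past `u v` with `|v| = m`, the
conditional law of the next letter `a` depends on `v` only, that is,
`P(a | u v) = P(a | v)` (written without quotients). -/
def IsMarkov (m : ℕ) (P : Measure (ℤ → A)) : Prop :=
  ∀ (i : ℤ) (u v : List A) (a : A), v.length = m →
    wordProb P i (u ++ v ++ [a]) * wordProb P (i + u.length) v =
      wordProb P i (u ++ v) * wordProb P (i + u.length) (v ++ [a])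

end Law

/-- Shannon entropy (natural logarithm) of a law on a finite set. -/
def entropy {T : Type*} [Fintype T] [MeasurableSpace T] (μ : Measure T) : ℝ :=
  ∑ t, Real.negMulLog (μ.real {t})

/-- The law of the erasure process: independent `E_n` with `P(E_n = 0) = ε = 1 - P(E_n = 1)`. -/
def erasureLaw (ε : unitInterval) : Measure (ℤ → Fin 2) :=
  Measure.infinitePi fun _ => ProbabilityTheory.bernoulliMeasure (0 : Fin 2) 1 ε

/-- The joint law of the input process, with law `P`, and the erasure process, which are
independent. -/
def jointLaw {K : ℕ} (P : Measure (ℤ → Input K)) (ε : unitInterval) :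
    Measure ((ℤ → Input K) × (ℤ → Fin 2)) :=
  P.prod (erasureLaw ε)

/-- The input block `X_1, …, X_n`. -/
def inputBlock {K : ℕ} (n : ℕ) (ω : (ℤ → Input K) × (ℤ → Fin 2)) : Fin n → Input K :=
  fun k => ω.1 ((k : ℕ) + 1)

/-- The output block `Y_1, …, Y_n`, where `Y_k = X_k E_k`. -/
def outputBlock {K : ℕ} (n : ℕ) (ω : (ℤ → Input K) × (ℤ → Fin 2)) : Fin n → Output K :=
  fun k => output (ω.1 ((k : ℕ) + 1)) (ω.2 ((k : ℕ) + 1))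

/-- The mutual information `I(X_1^n; Y_1^n) = H(X_1^n) + H(Y_1^n) - H(X_1^n, Y_1^n)`. -/
def blockInfo {K : ℕ} (P : Measure (ℤ → Input K)) (ε : unitInterval) (n : ℕ) : ℝ :=
  entropy ((jointLaw P ε).map (inputBlock n)) + entropy ((jointLaw P ε).map (outputBlock n))
    - entropy ((jointLaw P ε).map fun ω => (inputBlock n ω, outputBlock n ω))

/-- The mutual information rate `I(X; Y) = lim (1/n) I(X_1^n; Y_1^n)`. -/
def infoRate {K : ℕ} (P : Measure (ℤ → Input K)) (ε : unitInterval) : ℝ :=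
  limUnder atTop fun n : ℕ => blockInfo P ε n / n

/-- `P` is the law of a stationary input process supported on `S`. -/
structure IsInput {K : ℕ} (S : Set (List (Input K))) (P : Measure (ℤ → Input K)) : Prop where
  isProbabilityMeasure : IsProbabilityMeasure P
  isStationary : IsStationary P
  words_subset : words P ⊆ S

/-- The rates `I(X; Y)` of all stationary input processes supported on `S`. -/
def rates {K : ℕ} (S : Set (List (Input K))) (ε : unitInterval) : Set ℝ :=
  {r | ∃ P : Measure (ℤ → Input K), IsInput S P ∧ infoRate P ε = r}

/-- The rates `I(X; Y)` of all stationary `m`-th order Markov chains supported on `S`. -/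
def markovRates {K : ℕ} (m : ℕ) (S : Set (List (Input K))) (ε : unitInterval) : Set ℝ :=
  {r | ∃ P : Measure (ℤ → Input K), IsInput S P ∧ IsMarkov m P ∧ infoRate P ε = r}

/-- The capacity `C(S, ε)`. -/
def capacity {K : ℕ} (S : Set (List (Input K))) (ε : unitInterval) : ℝ :=
  sSup (rates S ε)

/-- The `m`-th order Markov capacity `C^{(m)}(S, ε)`. -/
def markovCapacity {K : ℕ} (m : ℕ) (S : Set (List (Input K))) (ε : unitInterval) : ℝ :=
  sSup (markovRates m S ε)

end

end ErasureChannel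

-- The erasure pattern can be read off the output, so I(X_1^n;Y_1^n) is the mean of H(X_R) over the
-- random set R of unerased times (`blockInfo_eq`). From there on, only monotonicity, submodularity
-- and shift invariance of R ↦ H(X_R), together with H(X_1) ≤ log 2, are needed to relate rates to a
-- few block entropies.
--
-- Upper bound. By submodularity and stationarity the increments of the mean entropies of blocks do
-- not increase, so the rate is at most the increment from two to three letters
-- (`IsInput.infoRate_le`). This is an explicit polynomial in ε and in entropies determined by π =
-- P(2) and s = P(212). A Gibbs inequality with quadratic remainder compares these with the
-- golden-mean chain of maximal entropy: the leading term is at most log λ minus a multiple of the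
-- squared deviation of (π, s) from that chain, while the coefficient of ε improves at most linearly
-- in the deviation. Trading a quadratic loss against ε times a linear gain costs only O(ε²),
-- uniformly in the input (`perturbed_rate_le`).
--
-- Lower bound. The chain of maximal entropy has rate log λ at ε = 0. Filling in the erased letters
-- one by one, each costs at most its conditional entropy given its two neighbours, unless a
-- neighbour is erased too or lies outside the block; the former has probability O(ε²) per letter
-- and the latter affects only the two ends (`IsBlockEntropy.le_erasureMean`). The middle letter is
-- free only when both neighbours are 1, which has probability 2/(1+λ²), and then it costs log 2.
--
-- This chain is Markov of every order n ≥ 1, so the same two bounds serve the capacity and all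
-- Markov capacities (`sSup_isBigO`).

namespace ErasureChannel

noncomputable section

-- Gibbs inequalities, data processing and submodularity of entropy

section Entropy

/-- The pointwise Gibbs inequality with a quadratic remainder. -/
theorem negMulLog_le_cross_sub_sq {p q : ℝ} (hp : 0 ≤ p) (hp1 : p ≤ 1) (hq : 0 ≤ q) (hq1 : q ≤ 1)
    (h : q = 0 → p = 0) :
    Real.negMulLog p ≤ -(p * Real.log q) - p + q - (p - q) ^ 2 / 4 := by
  rcases hp.eq_or_lt with rfl | hp0
  · simp only [Real.negMulLog_zero]; nlinarith
  have hq0 : 0 < q := lt_of_le_of_ne hq fun h0 => hp0.ne' (h h0.symm)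
  -- With p = a² and q = b², the bound log x ≤ x - 1 at x = b/a leaves a deficit of (a - b)², and (p
  -- - q)² = (a - b)²(a + b)² ≤ 4(a - b)².
  obtain ⟨a, ha, rfl⟩ : ∃ a : ℝ, 0 < a ∧ a ^ 2 = p := ⟨√p, by positivity, Real.sq_sqrt hp⟩
  obtain ⟨b, hb, rfl⟩ : ∃ b : ℝ, 0 < b ∧ b ^ 2 = q := ⟨√q, by positivity, Real.sq_sqrt hq⟩
  have ha1 : a ≤ 1 := by nlinarith
  have hb1 : b ≤ 1 := by nlinarith
  have hlog : Real.log b - Real.log a ≤ b / a - 1 := by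
    rw [← Real.log_div hb.ne' ha.ne']; exact Real.log_le_sub_one_of_pos (by positivity)
  have h2 : a ^ 2 * (Real.log b - Real.log a) ≤ a * b - a ^ 2 := by
    calc _ ≤ a ^ 2 * (b / a - 1) := by gcongr
      _ = _ := by field_simp
  have h3 : (a ^ 2 - b ^ 2) ^ 2 ≤ 4 * (a - b) ^ 2 := by
    have : (a + b) ^ 2 ≤ 4 := by nlinarith
    nlinarith [mul_le_mul_of_nonneg_left this (sq_nonneg (a - b))]
  simp only [Real.negMulLog, Real.log_pow]
  push_cast
  nlinarith

/-- The pointwise Gibbs inequality. -/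
theorem negMulLog_le_cross {p q : ℝ} (hp : 0 ≤ p) (hq : 0 ≤ q) (h : q = 0 → p = 0) :
    Real.negMulLog p ≤ -(p * Real.log q) - p + q := by
  rcases hp.eq_or_lt with rfl | hp0
  · simpa using hq
  have hq0 : 0 < q := lt_of_le_of_ne hq fun h0 => hp0.ne' (h h0.symm)
  have hlog : Real.log q - Real.log p ≤ q / p - 1 := by
    rw [← Real.log_div hq0.ne' hp0.ne']; exact Real.log_le_sub_one_of_pos (by positivity)
  have h2 : p * (Real.log q - Real.log p) ≤ q - p := by
    calc _ ≤ p * (q / p - 1) := by gcongr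
      _ = _ := by field_simp
  simp only [Real.negMulLog]
  nlinarith

theorem negMulLog_sum_le {ι : Type*} (s : Finset ι) (p : ι → ℝ) (hp : ∀ i ∈ s, 0 ≤ p i) :
    Real.negMulLog (∑ i ∈ s, p i) ≤ ∑ i ∈ s, Real.negMulLog (p i) := by
  rw [Real.negMulLog, neg_mul, Finset.sum_mul, ← Finset.sum_neg_distrib]
  refine Finset.sum_le_sum fun i hi => ?_
  rcases (hp i hi).eq_or_lt with h | h
  · simp [← h]
  · have := Real.log_le_log h (Finset.single_le_sum hp hi)
    simp only [Real.negMulLog]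
    nlinarith

/-- Gibbs inequality for p against the law u v / w, which makes the first two coordinates
conditionally independent given the third. Both have the same total mass, so the linear terms cancel
on summation. -/
theorem sum_negMulLog_submodular {A B C : Type*} [Fintype A] [Fintype B] [Fintype C]
    (p : A → B → C → ℝ) (hp : ∀ a b c, 0 ≤ p a b c) :
    ∑ a, ∑ b, ∑ c, Real.negMulLog (p a b c) + ∑ c, Real.negMulLog (∑ a, ∑ b, p a b c) ≤
      ∑ a, ∑ c, Real.negMulLog (∑ b, p a b c) + ∑ b, ∑ c, Real.negMulLog (∑ a, p a b c) := by
  set u : A → C → ℝ := fun a c => ∑ b, p a b c with hu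
  set v : B → C → ℝ := fun b c => ∑ a, p a b c with hv
  set w : C → ℝ := fun c => ∑ a, ∑ b, p a b c with hw
  have hwu : ∀ c, w c = ∑ a, u a c := fun c => rfl
  have hwv : ∀ c, w c = ∑ b, v b c := fun c => Finset.sum_comm
  have hu0 : ∀ a c, 0 ≤ u a c := fun a c => Finset.sum_nonneg fun b _ => hp a b c
  have hv0 : ∀ b c, 0 ≤ v b c := fun b c => Finset.sum_nonneg fun a _ => hp a b c
  have hw0 : ∀ c, 0 ≤ w c := fun c => Finset.sum_nonneg fun a _ => hu0 a c
  have hpu : ∀ a b c, p a b c ≤ u a c := fun a b c =>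
    Finset.single_le_sum (f := fun b => p a b c) (fun b _ => hp a b c) (Finset.mem_univ b)
  have hpv : ∀ a b c, p a b c ≤ v b c := fun a b c =>
    Finset.single_le_sum (f := fun a => p a b c) (fun a _ => hp a b c) (Finset.mem_univ a)
  have huw : ∀ a c, u a c ≤ w c := fun a c =>
    Finset.single_le_sum (f := fun a => u a c) (fun a _ => hu0 a c) (Finset.mem_univ a)
  have key : ∀ a b c, Real.negMulLog (p a b c) ≤
      -(p a b c * Real.log (u a c)) - p a b c * Real.log (v b c) + p a b c * Real.log (w c)
        - p a b c + u a c * v b c / w c := by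
    intro a b c
    have hq0 : 0 ≤ u a c * v b c / w c := div_nonneg (mul_nonneg (hu0 a c) (hv0 b c)) (hw0 c)
    rcases (hp a b c).eq_or_lt with h | h
    · simpa [← h] using hq0
    · have h1 : 0 < u a c := h.trans_le (hpu a b c)
      have h2 : 0 < v b c := h.trans_le (hpv a b c)
      have h3 : 0 < w c := h1.trans_le (huw a c)
      have := negMulLog_le_cross h.le hq0 fun h0 => absurd h0 (by positivity)
      rw [Real.log_div (by positivity) (by positivity), Real.log_mul h1.ne' h2.ne'] at this
      linarith
  have hsum := Finset.sum_le_sum fun a (_ : a ∈ Finset.univ) =>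
    Finset.sum_le_sum fun b (_ : b ∈ Finset.univ) =>
      Finset.sum_le_sum fun c (_ : c ∈ Finset.univ) => key a b c
  simp only [Finset.sum_add_distrib, Finset.sum_sub_distrib, Finset.sum_neg_distrib] at hsum
  have e1 : ∑ a, ∑ b, ∑ c, p a b c * Real.log (u a c) = -∑ a, ∑ c, Real.negMulLog (u a c) := by
    rw [← Finset.sum_neg_distrib]
    refine Finset.sum_congr rfl fun a _ => ?_
    rw [Finset.sum_comm, ← Finset.sum_neg_distrib]
    refine Finset.sum_congr rfl fun c _ => ?_
    rw [← Finset.sum_mul]; simp [Real.negMulLog, hu]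
  have e2 : ∑ a, ∑ b, ∑ c, p a b c * Real.log (v b c) = -∑ b, ∑ c, Real.negMulLog (v b c) := by
    rw [Finset.sum_comm, ← Finset.sum_neg_distrib]
    refine Finset.sum_congr rfl fun b _ => ?_
    rw [Finset.sum_comm, ← Finset.sum_neg_distrib]
    refine Finset.sum_congr rfl fun c _ => ?_
    rw [← Finset.sum_mul]; simp [Real.negMulLog, hv]
  have swap : ∀ g : A → B → C → ℝ, ∑ a, ∑ b, ∑ c, g a b c = ∑ c, ∑ a, ∑ b, g a b c := by
    intro g
    rw [Finset.sum_comm]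
    conv_rhs => rw [Finset.sum_comm]
    rw [Finset.sum_comm]
    exact Finset.sum_congr rfl fun a _ => Finset.sum_comm
  have e3 : ∑ a, ∑ b, ∑ c, p a b c * Real.log (w c) = -∑ c, Real.negMulLog (w c) := by
    rw [swap, ← Finset.sum_neg_distrib]
    refine Finset.sum_congr rfl fun c _ => ?_
    simp only [← Finset.sum_mul]; simp [Real.negMulLog, hw]
  have e4 : ∑ a, ∑ b, ∑ c, u a c * v b c / w c = ∑ a, ∑ b, ∑ c, p a b c := by
    rw [swap, swap]
    refine Finset.sum_congr rfl fun c _ => ?_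
    simp only [← Finset.sum_div, ← Finset.mul_sum, ← Finset.sum_mul]
    rw [← hwu, ← hwv]
    exact mul_self_div_self _
  linarith

variable {Ω : Type*} [MeasurableSpace Ω]
variable {T : Type*} [Fintype T] [MeasurableSpace T] [MeasurableSingletonClass T]
variable {S : Type*} [Fintype S] [MeasurableSpace S] [MeasurableSingletonClass S]

theorem real_map_singleton {S : Type*} [MeasurableSpace S] [MeasurableSingletonClass S]
    [DecidableEq S] (ν : Measure T) [IsFiniteMeasure ν] (φ : T → S) (s : S) :
    (ν.map φ).real {s} = ∑ t with φ t = s, ν.real {t} := by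
  rw [map_measureReal_apply (measurable_of_finite φ) (measurableSet_singleton s),
    sum_measureReal_singleton]
  congr 1
  ext t; simp

theorem entropy_map_le (ν : Measure T) [IsFiniteMeasure ν] (φ : T → S) :
    entropy (ν.map φ) ≤ entropy ν := by
  classical
  unfold entropy
  simp_rw [real_map_singleton ν φ]
  calc _ ≤ ∑ s, ∑ t with φ t = s, Real.negMulLog (ν.real {t}) :=
        Finset.sum_le_sum fun s _ => negMulLog_sum_le _ _ fun _ _ => measureReal_nonneg
    _ = _ := Finset.sum_fiberwise _ _ _

/-- If `f` is a function of `g`, then its entropy is at most that of `g`. -/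
theorem entropy_le_of_factors (μ : Measure Ω) [IsProbabilityMeasure μ] {f : Ω → S} {g : Ω → T}
    (hg : Measurable g) (h : ∀ x y, g x = g y → f x = f y) :
    entropy (μ.map f) ≤ entropy (μ.map g) := by
  obtain ⟨ω⟩ : Nonempty Ω := μ.nonempty_of_neZero
  have : Nonempty S := ⟨f ω⟩
  have hfac : Function.FactorsThrough f g := fun x y hxy => h x y hxy
  obtain ⟨φ, rfl⟩ := (Function.factorsThrough_iff f).1 hfac
  rw [← Measure.map_map (measurable_of_finite φ) hg]
  have := Measure.isProbabilityMeasure_map (μ := μ) hg.aemeasurable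
  exact entropy_map_le _ _

theorem entropy_eq_of_factors (μ : Measure Ω) [IsProbabilityMeasure μ] {f : Ω → S} {g : Ω → T}
    (hf : Measurable f) (hg : Measurable g) (h : ∀ x y, g x = g y ↔ f x = f y) :
    entropy (μ.map f) = entropy (μ.map g) :=
  le_antisymm (entropy_le_of_factors μ hg fun x y => (h x y).1)
    (entropy_le_of_factors μ hf fun x y => (h x y).2)

theorem entropy_nonneg {T : Type*} [Fintype T] [MeasurableSpace T] (ν : Measure T)
    [IsProbabilityMeasure ν] : 0 ≤ entropy ν :=
  Finset.sum_nonneg fun _ _ => Real.negMulLog_nonneg measureReal_nonneg measureReal_le_one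

/-- Submodularity of the entropy. -/
theorem entropy_submodular {A B C : Type*} [Fintype A] [MeasurableSpace A]
    [MeasurableSingletonClass A] [Fintype B] [MeasurableSpace B] [MeasurableSingletonClass B]
    [Fintype C] [MeasurableSpace C] [MeasurableSingletonClass C]
    (μ : Measure Ω) [IsProbabilityMeasure μ] {f : Ω → A} {g : Ω → B} {k : Ω → C}
    (hf : Measurable f) (hg : Measurable g) (hk : Measurable k) :
    entropy (μ.map fun ω => (f ω, g ω, k ω)) + entropy (μ.map k) ≤
      entropy (μ.map fun ω => (f ω, k ω)) + entropy (μ.map fun ω => (g ω, k ω)) := by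
  classical
  have hm : Measurable fun ω => (f ω, g ω, k ω) := hf.prodMk (hg.prodMk hk)
  set ν := μ.map fun ω => (f ω, g ω, k ω) with hν
  have : IsProbabilityMeasure ν := Measure.isProbabilityMeasure_map hm.aemeasurable
  have e1 : μ.map k = ν.map fun t => t.2.2 := by
    rw [hν, Measure.map_map (measurable_of_finite _) hm]; rfl
  have e2 : (μ.map fun ω => (f ω, k ω)) = ν.map fun t => (t.1, t.2.2) := by
    rw [hν, Measure.map_map (measurable_of_finite _) hm]; rfl
  have e3 : (μ.map fun ω => (g ω, k ω)) = ν.map fun t => (t.2.1, t.2.2) := by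
    rw [hν, Measure.map_map (measurable_of_finite _) hm]; rfl
  rw [e1, e2, e3]
  unfold entropy
  have h := sum_negMulLog_submodular (fun a b c => ν.real {(a, b, c)})
    fun _ _ _ => measureReal_nonneg
  simp_rw [real_map_singleton ν, Fintype.sum_prod_type, Finset.sum_filter, Fintype.sum_prod_type,
    Prod.mk.injEq]
  convert h using 2
  · refine Finset.sum_congr rfl fun c _ => ?_
    simp
  · refine Finset.sum_congr rfl fun a _ => Finset.sum_congr rfl fun c _ => ?_
    congr 1
    rw [Finset.sum_eq_single a] <;> simp +contextual
  · refine Finset.sum_congr rfl fun b _ => Finset.sum_congr rfl fun c _ => ?_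
    congr 1
    refine Finset.sum_congr rfl fun a _ => ?_
    rw [Finset.sum_eq_single b] <;> simp +contextual

end Entropy

-- Averages over the random set of surviving positions

section ErasureMean

variable {ι : Type*} [DecidableEq ι]

/-- The mean of `g R`, where `R` is a random subset of `S` that keeps each element independently
with probability `1 - ε`. -/
def erasureMean (ε : ℝ) (S : Finset ι) (g : Finset ι → ℝ) : ℝ :=
  ∑ R ∈ S.powerset, (1 - ε) ^ R.card * ε ^ (S \ R).card * g R

theorem erasureMean_empty (ε : ℝ) (g : Finset ι → ℝ) : erasureMean ε ∅ g = g ∅ := by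
  simp [erasureMean]

/-- Conditioning on whether `a` is erased; this recursion is the basis of the inductions and
explicit evaluations below. -/
theorem erasureMean_insert (ε : ℝ) {a : ι} {S : Finset ι} (ha : a ∉ S) (g : Finset ι → ℝ) :
    erasureMean ε (insert a S) g =
      ε * erasureMean ε S g + (1 - ε) * erasureMean ε S (fun R => g (insert a R)) := by
  unfold erasureMean
  rw [Finset.sum_powerset_insert ha, Finset.mul_sum, Finset.mul_sum]
  congr 1 <;> refine Finset.sum_congr rfl fun R hR => ?_
  · have haR : a ∉ R := fun h => ha (Finset.mem_powerset.1 hR h)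
    rw [Finset.insert_sdiff_of_notMem _ haR, Finset.card_insert_of_notMem (by simp [ha])]
    ring
  · have haR : a ∉ R := fun h => ha (Finset.mem_powerset.1 hR h)
    rw [Finset.card_insert_of_notMem haR, Finset.insert_sdiff_insert,
      Finset.sdiff_insert_of_notMem ha]
    ring

theorem erasureMean_congr (ε : ℝ) {S : Finset ι} {g g' : Finset ι → ℝ}
    (h : ∀ R ⊆ S, g R = g' R) : erasureMean ε S g = erasureMean ε S g' :=
  Finset.sum_congr rfl fun R hR => by rw [h R (Finset.mem_powerset.1 hR)]

theorem erasureMean_mono {ε : ℝ} (h0 : 0 ≤ ε) (h1 : ε ≤ 1) {S : Finset ι} {g g' : Finset ι → ℝ}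
    (h : ∀ R ⊆ S, g R ≤ g' R) : erasureMean ε S g ≤ erasureMean ε S g' := by
  have : 0 ≤ 1 - ε := by linarith
  exact Finset.sum_le_sum fun R hR =>
    mul_le_mul_of_nonneg_left (h R (Finset.mem_powerset.1 hR)) (by positivity)

theorem erasureMean_add (ε : ℝ) (S : Finset ι) (g g' : Finset ι → ℝ) :
    erasureMean ε S (fun R => g R + g' R) = erasureMean ε S g + erasureMean ε S g' := by
  simp only [erasureMean, mul_add, Finset.sum_add_distrib]

theorem erasureMean_const_mul (ε : ℝ) (S : Finset ι) (c : ℝ) (g : Finset ι → ℝ) :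
    erasureMean ε S (fun R => c * g R) = c * erasureMean ε S g := by
  simp only [erasureMean, Finset.mul_sum]
  exact Finset.sum_congr rfl fun R _ => by ring

theorem erasureMean_sum (ε : ℝ) (S : Finset ι) {κ : Type*} (t : Finset κ)
    (g : κ → Finset ι → ℝ) :
    erasureMean ε S (fun R => ∑ i ∈ t, g i R) = ∑ i ∈ t, erasureMean ε S (g i) := by
  simp only [erasureMean, Finset.mul_sum]
  exact Finset.sum_comm

/-- The part of the random subset of `U` in `S ⊆ U` is the random subset of `S`. -/
theorem erasureMean_inter (ε : ℝ) {S U : Finset ι} (h : S ⊆ U) (g : Finset ι → ℝ) :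
    erasureMean ε U (fun R => g (R ∩ S)) = erasureMean ε S g := by
  suffices H : ∀ V : Finset ι, Disjoint S V →
      erasureMean ε (V ∪ S) (fun R => g (R ∩ S)) = erasureMean ε S g by
    have := H (U \ S) Finset.disjoint_sdiff
    rwa [Finset.sdiff_union_of_subset h] at this
  intro V
  induction V using Finset.induction_on with
  | empty =>
    intro _
    rw [Finset.empty_union]
    exact erasureMean_congr ε fun R hR => by rw [Finset.inter_eq_left.2 hR]
  | insert a V ha ih =>
    intro hd
    rw [Finset.disjoint_insert_right] at hd
    rw [Finset.insert_union, erasureMean_insert ε (by simp [ha, hd.1]), ih hd.2]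
    simp only [Finset.insert_inter_of_notMem hd.1]
    rw [ih hd.2]
    ring

theorem erasureMean_const (ε : ℝ) (S : Finset ι) (c : ℝ) :
    erasureMean ε S (fun _ => c) = c := by
  have := erasureMean_inter ε (Finset.empty_subset S) (fun _ => c)
  rw [this, erasureMean_empty]

theorem erasureMean_map (ε : ℝ) {κ : Type*} [DecidableEq κ] (f : κ ↪ ι) (S : Finset κ)
    (g : Finset ι → ℝ) :
    erasureMean ε (S.map f) g = erasureMean ε S (fun R => g (R.map f)) := by
  induction S using Finset.induction_on generalizing g with
  | empty => simp [erasureMean_empty]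
  | insert a S ha ih =>
    rw [Finset.map_insert, erasureMean_insert ε (by simpa using ha), erasureMean_insert ε ha, ih, ih]
    simp only [Finset.map_insert]

theorem erasureMean_notMem (ε : ℝ) {S : Finset ι} {i : ι} (hi : i ∈ S) :
    erasureMean ε S (fun R => if i ∈ R then 0 else 1) = ε := by
  have := erasureMean_inter ε (Finset.singleton_subset_iff.2 hi) (fun R => if i ∈ R then 0 else 1)
  simp only [Finset.mem_inter, Finset.mem_singleton, and_true] at this
  rw [this, ← insert_empty_eq, erasureMean_insert ε (by simp)]
  simp [erasureMean_empty]

theorem erasureMean_notMem_notMem (ε : ℝ) {S : Finset ι} {i j : ι} (hi : i ∈ S) (hj : j ∈ S)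
    (hij : i ≠ j) :
    erasureMean ε S (fun R => if i ∈ R then 0 else if j ∈ R then 0 else 1) = ε ^ 2 := by
  have := erasureMean_inter ε (S := {i, j}) (U := S)
    (by simp [Finset.insert_subset_iff, hi, hj])
    (fun R => if i ∈ R then 0 else if j ∈ R then 0 else 1)
  simp only [Finset.mem_inter, Finset.mem_insert, Finset.mem_singleton, or_true, true_or,
    and_true] at this
  rw [this, erasureMean_insert ε (by simpa using hij), ← insert_empty_eq,
    erasureMean_insert ε (by simp), erasureMean_insert ε (by simp)]
  simp [erasureMean_empty, hij]
  ring

end ErasureMean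

-- Consequences of submodularity for erased blocks

section Polymatroid

/-- The properties of the block entropies of a stationary process over a binary alphabet. -/
structure IsBlockEntropy (h : Finset ℤ → ℝ) : Prop where
  empty : h ∅ = 0
  mono : ∀ S T, S ⊆ T → h S ≤ h T
  submodular : ∀ S T, h (S ∪ T) + h (S ∩ T) ≤ h S + h T
  shift : ∀ (c : ℤ) S, h (S.map (addRightEmbedding c)) = h S
  singleton_le : h {1} ≤ Real.log 2

variable {h : Finset ℤ → ℝ} {ε : ℝ}

namespace IsBlockEntropy

theorem nonneg (hh : IsBlockEntropy h) (S : Finset ℤ) : 0 ≤ h S :=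
  hh.empty ▸ hh.mono _ _ (Finset.empty_subset S)

/-- All four means become means over one random subset R of S ∪ T, and submodularity is applied to R
∩ S and R ∩ T for each R. -/
theorem erasureMean_submodular (hh : IsBlockEntropy h) (h0 : 0 ≤ ε) (h1 : ε ≤ 1)
    (S T : Finset ℤ) :
    erasureMean ε (S ∪ T) h + erasureMean ε (S ∩ T) h ≤ erasureMean ε S h + erasureMean ε T h := by
  rw [← erasureMean_inter ε (Finset.inter_subset_union : S ∩ T ⊆ S ∪ T) h,
    ← erasureMean_inter ε (Finset.subset_union_left : S ⊆ S ∪ T) h,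
    ← erasureMean_inter ε (Finset.subset_union_right : T ⊆ S ∪ T) h,
    ← erasureMean_add, ← erasureMean_add]
  refine erasureMean_mono h0 h1 fun R hR => ?_
  have := hh.submodular (R ∩ S) (R ∩ T)
  rwa [← Finset.inter_union_distrib_left, Finset.inter_eq_left.2 hR,
    ← Finset.inter_inter_distrib_left] at this

theorem erasureMean_Icc (hh : IsBlockEntropy h) (a b c : ℤ) :
    erasureMean ε (Finset.Icc (a + c) (b + c)) h = erasureMean ε (Finset.Icc a b) h := by
  rw [← Finset.map_add_right_Icc, erasureMean_map]
  exact erasureMean_congr ε fun R _ => hh.shift c R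

theorem erasureMean_nonneg (hh : IsBlockEntropy h) (h0 : 0 ≤ ε) (h1 : ε ≤ 1) (S : Finset ℤ) :
    0 ≤ erasureMean ε S h := by
  have := erasureMean_mono h0 h1 (S := S) (g := fun _ => 0) (g' := h) fun R _ => hh.nonneg R
  rwa [erasureMean_const] at this

theorem subadditive (hh : IsBlockEntropy h) (h0 : 0 ≤ ε) (h1 : ε ≤ 1) :
    Subadditive fun n : ℕ => erasureMean ε (Finset.Icc 1 (n : ℤ)) h := by
  intro m n
  have hs := hh.erasureMean_submodular h0 h1 (Finset.Icc 1 (m : ℤ)) (Finset.Icc (1 + m) (n + m : ℤ))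
  rw [hh.erasureMean_Icc] at hs
  have hu : Finset.Icc 1 (m : ℤ) ∪ Finset.Icc (1 + m) (n + m : ℤ) = Finset.Icc 1 ((m + n : ℕ) : ℤ) := by
    ext x; simp only [Finset.mem_union, Finset.mem_Icc]; omega
  rw [hu] at hs
  linarith [hh.erasureMean_nonneg h0 h1 (Finset.Icc 1 (m : ℤ) ∩ Finset.Icc (1 + m) (n + m : ℤ))]

/-- Submodularity for the block {1, …, n} and the window {n-1, n, n+1}, whose intersection is {n-1,
n}: conditioning on more of the past cannot raise the increment. -/
theorem erasureMean_succ_le (hh : IsBlockEntropy h) (h0 : 0 ≤ ε) (h1 : ε ≤ 1) {n : ℕ} (hn : 2 ≤ n) :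
    erasureMean ε (Finset.Icc 1 ((n + 1 : ℕ) : ℤ)) h ≤ erasureMean ε (Finset.Icc 1 (n : ℤ)) h +
      (erasureMean ε (Finset.Icc 1 3) h - erasureMean ε (Finset.Icc 1 2) h) := by
  have hs := hh.erasureMean_submodular h0 h1 (Finset.Icc 1 (n : ℤ))
    (Finset.Icc (1 + (n - 2)) (3 + (n - 2) : ℤ))
  rw [hh.erasureMean_Icc] at hs
  have hu : Finset.Icc 1 (n : ℤ) ∪ Finset.Icc (1 + (n - 2)) (3 + (n - 2) : ℤ) =
      Finset.Icc 1 ((n + 1 : ℕ) : ℤ) := by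
    ext x; simp only [Finset.mem_union, Finset.mem_Icc]; omega
  have hi : Finset.Icc 1 (n : ℤ) ∩ Finset.Icc (1 + (n - 2)) (3 + (n - 2) : ℤ) =
      Finset.Icc (1 + ((n : ℤ) - 2)) (2 + ((n : ℤ) - 2)) := by
    ext x; simp only [Finset.mem_inter, Finset.mem_Icc]; omega
  rw [hu, hi, hh.erasureMean_Icc] at hs
  linarith

theorem erasureMean_add_two_le (hh : IsBlockEntropy h) (h0 : 0 ≤ ε) (h1 : ε ≤ 1) (n : ℕ) :
    erasureMean ε (Finset.Icc 1 ((n + 2 : ℕ) : ℤ)) h ≤ erasureMean ε (Finset.Icc 1 2) h +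
      n * (erasureMean ε (Finset.Icc 1 3) h - erasureMean ε (Finset.Icc 1 2) h) := by
  induction n with
  | zero => simp
  | succ n ih =>
    have := hh.erasureMean_succ_le h0 h1 (n := n + 2) (by omega)
    rw [show n + 1 + 2 = n + 2 + 1 by ring]
    push_cast at *
    linarith

/-- The increment of the mean entropies from two to three letters. -/
theorem erasureMean_three_sub_two (hh : IsBlockEntropy h) :
    erasureMean ε (Finset.Icc 1 3) h - erasureMean ε (Finset.Icc 1 2) h =
      (1 - ε) * ((1 - ε) ^ 2 * (h {1, 2, 3} - h {1, 2}) +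
        ε * (1 - ε) * ((h {1, 2} - h {1}) + (h {1, 3} - h {1})) + ε ^ 2 * h {1}) := by
  have h3 : (Finset.Icc 1 3 : Finset ℤ) = insert 1 (insert 2 (insert 3 ∅)) := by decide
  have h2 : (Finset.Icc 1 2 : Finset ℤ) = insert 1 (insert 2 ∅) := by decide
  -- In the formula the outer 1 - ε says that an end letter survives; the bracket averages its
  -- conditional entropy over the four erasure patterns of the other two letters. Shifts bring all
  -- sets into standard position.
  have e2 : h {2} = h {1} := by simpa using hh.shift 1 {1}
  have e3 : h {3} = h {1} := by simpa using hh.shift 2 {1}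
  have e23 : h {2, 3} = h {1, 2} := by simpa using hh.shift 1 {1, 2}
  rw [h3, h2]
  simp only [erasureMean_insert ε (show (1 : ℤ) ∉ insert 2 (insert 3 (∅ : Finset ℤ)) by decide),
    erasureMean_insert ε (show (1 : ℤ) ∉ insert 2 (∅ : Finset ℤ) by decide),
    erasureMean_insert ε (show (2 : ℤ) ∉ insert 3 (∅ : Finset ℤ) by decide),
    erasureMean_insert ε (Finset.notMem_empty (2 : ℤ)),
    erasureMean_insert ε (Finset.notMem_empty (3 : ℤ)), erasureMean_empty]
  simp only [insert_empty_eq, hh.empty, e2, e3, e23]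
  ring

theorem erasureMean_one (hh : IsBlockEntropy h) :
    erasureMean ε (Finset.Icc 1 1) h = (1 - ε) * h {1} := by
  rw [Finset.Icc_self, ← insert_empty_eq, erasureMean_insert ε (Finset.notMem_empty _),
    erasureMean_empty, erasureMean_empty, hh.empty]
  simp

/-- The chain rule with all conditioning except that on R dropped. -/
theorem union_sub_le_sum (hh : IsBlockEntropy h) (R V : Finset ℤ) :
    h (V ∪ R) - h R ≤ ∑ i ∈ V, (h (insert i R) - h R) := by
  induction V using Finset.induction_on with
  | empty => simp
  | insert a V ha ih =>
    rw [Finset.sum_insert ha]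
    have hs := hh.submodular (V ∪ R) (insert a R)
    have hu : V ∪ R ∪ insert a R = insert a V ∪ R := by grind
    have := hh.mono R ((V ∪ R) ∩ insert a R)
      (Finset.subset_inter Finset.subset_union_right (Finset.subset_insert a R))
    rw [hu] at hs
    linarith

/-- If both neighbours of i lie in R, conditioning on R is at least as strong as conditioning on the
neighbours. If one is missing, the entropy of a single letter is at most log 2. -/
theorem insert_sub_le (hh : IsBlockEntropy h) (R : Finset ℤ) {i : ℤ} (hi : i ∉ R) :
    h (insert i R) - h R ≤ (h {1, 2, 3} - h {1, 3}) +
      Real.log 2 * ((if i - 1 ∈ R then 0 else 1) + (if i + 1 ∈ R then 0 else 1)) := by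
  have hF : 0 ≤ h {1, 2, 3} - h {1, 3} := sub_nonneg.2 (hh.mono _ _ (by decide))
  have hlog : 0 ≤ Real.log 2 := (Real.log_pos (by norm_num)).le
  have hone : h (insert i R) - h R ≤ Real.log 2 := by
    have hs := hh.submodular {i} R
    have he : h {i} = h {1} := by simpa using hh.shift (i - 1) {1}
    rw [Finset.singleton_inter_of_notMem hi, hh.empty, ← Finset.insert_eq] at hs
    linarith [hh.singleton_le]
  by_cases hl : i - 1 ∈ R
  · by_cases hr : i + 1 ∈ R
    · have hs := hh.submodular R {i - 1, i, i + 1}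
      have hu : R ∪ {i - 1, i, i + 1} = insert i R := by
        ext x; simp only [Finset.mem_union, Finset.mem_insert, Finset.mem_singleton]
        constructor
        · rintro (h | rfl | rfl | rfl) <;> simp [*]
        · tauto
      have hn : R ∩ {i - 1, i, i + 1} = {i - 1, i + 1} := by
        ext x; simp only [Finset.mem_inter, Finset.mem_insert, Finset.mem_singleton]
        constructor
        · rintro ⟨h, rfl | rfl | rfl⟩ <;> simp_all
        · rintro (rfl | rfl) <;> simp [*]
      have e1 : h {i - 1, i, i + 1} = h {1, 2, 3} := by
        rw [← hh.shift (i - 2) {1, 2, 3}]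
        congr 1
        simp only [Finset.map_insert, Finset.map_singleton, addRightEmbedding_apply]
        congr 1; · ring
        congr 1; · ring
        congr 1; ring
      have e2 : h {i - 1, i + 1} = h {1, 3} := by
        rw [← hh.shift (i - 2) {1, 3}]
        congr 1
        simp only [Finset.map_insert, Finset.map_singleton, addRightEmbedding_apply]
        congr 1; · ring
        congr 1; ring
      rw [hu, hn, e1, e2] at hs
      simp only [hl, hr, if_true]
      linarith
    · simp only [hl, hr, if_true, if_false]; linarith
  · simp only [hl, if_false]
    split_ifs <;> linarith

/-- Erasures cost at most the conditional entropy of a letter given its two neighbours, up to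
second order. -/
theorem le_erasureMean (hh : IsBlockEntropy h) (h0 : 0 ≤ ε) (h1 : ε ≤ 1) (n : ℕ) :
    h (Finset.Icc 1 (n : ℤ)) - n * (ε * (h {1, 2, 3} - h {1, 3}) + 2 * Real.log 2 * ε ^ 2)
      - 2 * Real.log 2 ≤ erasureMean ε (Finset.Icc 1 (n : ℤ)) h := by
  set U := Finset.Icc 1 (n : ℤ) with hU
  set F := h {1, 2, 3} - h {1, 3} with hF
  have hlog : 0 ≤ Real.log 2 := (Real.log_pos (by norm_num)).le
  -- χ i indicates that i is erased, ψ i j that i and j both are. A time j outside U counts as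
  -- erased.
  let χ : ℤ → Finset ℤ → ℝ := fun i R => if i ∈ R then 0 else 1
  let ψ : ℤ → ℤ → Finset ℤ → ℝ := fun i j R => if i ∈ R then 0 else if j ∈ R then 0 else 1
  have hpt : ∀ R ⊆ U, h U ≤ h R +
      ∑ i ∈ U, (F * χ i R + (Real.log 2 * ψ i (i - 1) R + Real.log 2 * ψ i (i + 1) R)) := by
    intro R hR
    have hs := hh.union_sub_le_sum R (U \ R)
    rw [Finset.sdiff_union_of_subset hR] at hs
    have : ∑ i ∈ U \ R, (h (insert i R) - h R) ≤
        ∑ i ∈ U, (F * χ i R + (Real.log 2 * ψ i (i - 1) R + Real.log 2 * ψ i (i + 1) R)) := by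
      rw [← Finset.sum_sdiff hR]
      have hz : ∑ i ∈ R, (F * χ i R + (Real.log 2 * ψ i (i - 1) R + Real.log 2 * ψ i (i + 1) R))
          = 0 := Finset.sum_eq_zero fun i hi => by simp [χ, ψ, hi]
      rw [hz, add_zero]
      refine Finset.sum_le_sum fun i hi => ?_
      have hi' := (Finset.mem_sdiff.1 hi).2
      have := hh.insert_sub_le R hi'
      simp only [χ, ψ, hi', if_false]
      linarith
    linarith
  have hmean := erasureMean_mono h0 h1 hpt
  rw [erasureMean_const, erasureMean_add, erasureMean_sum] at hmean
  simp only [erasureMean_add, erasureMean_const_mul] at hmean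
  have hχ : ∀ i ∈ U, erasureMean ε U (χ i) = ε := fun i hi => erasureMean_notMem ε hi
  -- The extra 1 pays for neighbours outside the block. Only the two end letters have one, whence
  -- the additive 2 log 2 that does not grow with n.
  have hψ : ∀ i ∈ U, ∀ j, i ≠ j → erasureMean ε U (ψ i j) ≤ ε ^ 2 + if j ∈ U then 0 else 1 := by
    intro i hi j hij
    split_ifs with hj
    · rw [add_zero]; exact (erasureMean_notMem_notMem ε hi hj hij).le
    · have : erasureMean ε U (ψ i j) ≤ erasureMean ε U (fun _ => 1) :=
        erasureMean_mono h0 h1 fun R _ => by simp only [ψ]; split_ifs <;> norm_num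
      rw [erasureMean_const] at this
      nlinarith [sq_nonneg ε]
  have hsum : ∑ i ∈ U, (F * erasureMean ε U (χ i) + (Real.log 2 * erasureMean ε U (ψ i (i - 1)) +
      Real.log 2 * erasureMean ε U (ψ i (i + 1)))) ≤
      ∑ i ∈ U, (F * ε + 2 * Real.log 2 * ε ^ 2 + Real.log 2 * ((if i - 1 ∈ U then 0 else 1) +
        (if i + 1 ∈ U then 0 else 1))) := by
    refine Finset.sum_le_sum fun i hi => ?_
    rw [hχ i hi]
    have a1 := mul_le_mul_of_nonneg_left (hψ i hi (i - 1) (by omega)) hlog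
    have a2 := mul_le_mul_of_nonneg_left (hψ i hi (i + 1) (by omega)) hlog
    linarith
  have hb : ∑ i ∈ U, ((if i - 1 ∈ U then (0 : ℝ) else 1) + (if i + 1 ∈ U then 0 else 1)) ≤ 2 := by
    rw [Finset.sum_add_distrib]
    have c1 : ∑ i ∈ U, (if i - 1 ∈ U then (0 : ℝ) else 1) ≤ 1 := by
      rw [← Finset.sum_subset (Finset.filter_subset (· = 1) U)]
      · calc _ ≤ ∑ i ∈ U with i = 1, (1 : ℝ) := Finset.sum_le_sum fun i _ => by split_ifs <;> norm_num
          _ ≤ 1 := by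
            simp only [Finset.sum_const, nsmul_eq_mul, mul_one]
            exact_mod_cast Finset.card_le_one.2 fun a ha b hb => by simp_all
      · intro i hi hi'
        rw [if_pos]
        simp only [Finset.mem_filter, hU, Finset.mem_Icc] at hi hi' ⊢
        omega
    have c2 : ∑ i ∈ U, (if i + 1 ∈ U then (0 : ℝ) else 1) ≤ 1 := by
      rw [← Finset.sum_subset (Finset.filter_subset (· = (n : ℤ)) U)]
      · calc _ ≤ ∑ i ∈ U with i = (n : ℤ), (1 : ℝ) :=
              Finset.sum_le_sum fun i _ => by split_ifs <;> norm_num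
          _ ≤ 1 := by
            simp only [Finset.sum_const, nsmul_eq_mul, mul_one]
            exact_mod_cast Finset.card_le_one.2 fun a ha b hb => by simp_all
      · intro i hi hi'
        rw [if_pos]
        simp only [Finset.mem_filter, hU, Finset.mem_Icc] at hi hi' ⊢
        omega
    linarith
  have hsplit : ∑ i ∈ U, (F * ε + 2 * Real.log 2 * ε ^ 2 + Real.log 2 *
      ((if i - 1 ∈ U then (0 : ℝ) else 1) + (if i + 1 ∈ U then 0 else 1))) =
      U.card * (F * ε + 2 * Real.log 2 * ε ^ 2) + Real.log 2 *
        ∑ i ∈ U, ((if i - 1 ∈ U then (0 : ℝ) else 1) + (if i + 1 ∈ U then 0 else 1)) := by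
    rw [Finset.sum_add_distrib, ← Finset.mul_sum, Finset.sum_const, nsmul_eq_mul]
  have hcard : (U.card : ℝ) = n := by simp [hU]
  rw [hsplit, hcard] at hsum
  have := mul_le_mul_of_nonneg_left hb hlog
  linarith

end IsBlockEntropy

end Polymatroid

-- Mutual information when the noise is visible in the output

section Mixture

variable {A B T : Type*} [Fintype A] [MeasurableSpace A] [MeasurableSingletonClass A]
  [Fintype B] [MeasurableSpace B] [MeasurableSingletonClass B]
  [Fintype T] [MeasurableSpace T] [MeasurableSingletonClass T]

theorem entropy_le_log_card (ν : Measure T) [IsProbabilityMeasure ν] :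
    entropy ν ≤ Real.log (Fintype.card T) := by
  obtain ⟨t⟩ : Nonempty T := ν.nonempty_of_neZero
  have hc : (0 : ℝ) < Fintype.card T := by exact_mod_cast Fintype.card_pos_iff.2 ⟨t⟩
  have hs : ∑ t, ν.real {t} = 1 := by simp [sum_measureReal_singleton]
  have h := Finset.sum_le_sum fun t (_ : t ∈ (Finset.univ : Finset T)) =>
    negMulLog_le_cross (p := ν.real {t}) (q := (Fintype.card T : ℝ)⁻¹) measureReal_nonneg
      (by positivity) fun h0 => absurd h0 (by positivity)
  refine h.trans (le_of_eq ?_)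
  rw [Finset.sum_add_distrib, Finset.sum_sub_distrib, Finset.sum_neg_distrib, ← Finset.sum_mul, hs,
    Finset.sum_const, Finset.card_univ, nsmul_eq_mul, mul_inv_cancel₀ hc.ne', Real.log_inv]
  ring

theorem real_prod_map_singleton {T : Type*} [MeasurableSpace T] [MeasurableSingletonClass T]
    (α : Measure A) (β : Measure B) [IsProbabilityMeasure α]
    [IsProbabilityMeasure β] (φ : A → B → T) (t : T) :
    ((α.prod β).map fun z => φ z.1 z.2).real {t} =
      ∑ b, β.real {b} * (α.map fun a => φ a b).real {t} := by
  classical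
  rw [real_map_singleton]
  simp_rw [real_map_singleton, Finset.sum_filter, Fintype.sum_prod_type, Finset.mul_sum]
  rw [Finset.sum_comm]
  refine Finset.sum_congr rfl fun b _ => Finset.sum_congr rfl fun a _ => ?_
  rw [← Set.singleton_prod_singleton, measureReal_prod_prod]
  split_ifs <;> ring

/-- Applies to a fixed output: at most one noise value can produce it, so the mixture sum has at
most one nonzero term. -/
theorem negMulLog_sum_of_subsingleton_support {ι : Type*} [Fintype ι] (p : ι → ℝ)
    (h : ∀ i j, p i ≠ 0 → p j ≠ 0 → i = j) :
    Real.negMulLog (∑ i, p i) = ∑ i, Real.negMulLog (p i) := by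
  by_cases hz : ∀ i, p i = 0
  · simp [hz]
  · push Not at hz
    obtain ⟨i, hi⟩ := hz
    have h0 : ∀ j, j ≠ i → p j = 0 := fun j hj => by_contra fun hne => hj (h j i hne hi)
    rw [Fintype.sum_eq_single i h0, Fintype.sum_eq_single i fun j hj => by simp [h0 j hj]]

/-- The entropy of a mixture of laws with disjoint supports. -/
theorem entropy_mixture (α : Measure A) (β : Measure B) [IsProbabilityMeasure α]
    [IsProbabilityMeasure β] (φ : A → B → T) (hφ : ∀ a a' b b', φ a b = φ a' b' → b = b') :
    entropy ((α.prod β).map fun z => φ z.1 z.2) =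
      ∑ b, β.real {b} * entropy (α.map fun a => φ a b) + entropy β := by
  classical
  have hpos : ∀ b t, (α.map fun a => φ a b).real {t} ≠ 0 → ∃ a, φ a b = t := by
    intro b t h
    rw [real_map_singleton] at h
    obtain ⟨a, ha, -⟩ := Finset.exists_ne_zero_of_sum_ne_zero h
    exact ⟨a, (Finset.mem_filter.1 ha).2⟩
  have h1 : ∀ b, ∑ t, (α.map fun a => φ a b).real {t} = 1 := by
    intro b
    have : IsProbabilityMeasure (α.map fun a => φ a b) :=
      Measure.isProbabilityMeasure_map (measurable_of_finite _).aemeasurable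
    simp [sum_measureReal_singleton]
  unfold entropy
  have : ∀ t, Real.negMulLog (((α.prod β).map fun z => φ z.1 z.2).real {t}) =
      ∑ b, ((α.map fun a => φ a b).real {t} * Real.negMulLog (β.real {b}) +
        β.real {b} * Real.negMulLog ((α.map fun a => φ a b).real {t})) := by
    intro t
    rw [real_prod_map_singleton, negMulLog_sum_of_subsingleton_support]
    · simp_rw [Real.negMulLog_mul]
    · intro b b' hb hb'
      obtain ⟨a, ha⟩ := hpos b t (right_ne_zero_of_mul hb)
      obtain ⟨a', ha'⟩ := hpos b' t (right_ne_zero_of_mul hb')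
      exact hφ a a' b b' (ha.trans ha'.symm)
  simp_rw [this]
  rw [Finset.sum_comm, ← Finset.sum_add_distrib]
  refine Finset.sum_congr rfl fun b _ => ?_
  rw [Finset.sum_add_distrib, ← Finset.sum_mul, h1, Finset.mul_sum]
  ring

/-- The mutual information between the input and the output of a channel with independent noise
that can be read off the output. -/
theorem mutualInfo_eq_sum (α : Measure A) (β : Measure B) [IsProbabilityMeasure α]
    [IsProbabilityMeasure β] (φ : A → B → T) (hφ : ∀ a a' b b', φ a b = φ a' b' → b = b') :
    entropy α + entropy ((α.prod β).map fun z => φ z.1 z.2) -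
        entropy ((α.prod β).map fun z => (z.1, φ z.1 z.2)) =
      ∑ b, β.real {b} * entropy (α.map fun a => φ a b) := by
  rw [entropy_mixture α β φ hφ, entropy_mixture α β (fun a b => (a, φ a b))
    fun a a' b b' h => hφ a a' b b' (Prod.ext_iff.1 h).2]
  -- The pair (a, φ a b) carries exactly the information of a when b is fixed.
  have : ∀ b, entropy (α.map fun a => (a, φ a b)) = entropy α := by
    intro b
    have h := entropy_eq_of_factors α (f := fun a => (a, φ a b)) (g := id)
      (measurable_of_finite _) measurable_id (fun x y => by simp +contextual)
    rwa [Measure.map_id] at h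
  have h1 : ∑ b, β.real {b} = 1 := by simp [sum_measureReal_singleton]
  simp_rw [this]
  rw [← Finset.sum_mul, h1]
  ring

end Mixture

-- Block entropies of a stationary process

section BlockEntropy

/-- The entropy of the letters of a process at the times in `S`. -/
def blockEntropy {A : Type*} [Fintype A] [MeasurableSpace A] (P : Measure (ℤ → A))
    (S : Finset ℤ) : ℝ :=
  entropy (P.map S.restrict)

theorem restrict_eq_iff {A : Type*} {S : Finset ℤ} {x y : ℤ → A} :
    S.restrict x = S.restrict y ↔ ∀ i ∈ S, x i = y i := by
  simp [funext_iff]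

variable {A : Type*} [Fintype A] [MeasurableSpace A] [MeasurableSingletonClass A]

theorem blockEntropy_eq (P : Measure (ℤ → A)) [IsProbabilityMeasure P] {T : Type*} [Fintype T]
    [MeasurableSpace T] [MeasurableSingletonClass T] {S : Finset ℤ} {f : (ℤ → A) → T}
    (hf : Measurable f) (h : ∀ x y, f x = f y ↔ ∀ i ∈ S, x i = y i) :
    blockEntropy P S = entropy (P.map f) :=
  entropy_eq_of_factors P (Finset.measurable_restrict S) hf fun x y =>
    (h x y).trans restrict_eq_iff.symm

theorem blockEntropy_shift_one {P : Measure (ℤ → A)} [IsProbabilityMeasure P] (hP : IsStationary P)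
    (S : Finset ℤ) : blockEntropy P (S.map (addRightEmbedding 1)) = blockEntropy P S := by
  have hm : Measurable fun x : ℤ → A => S.restrict fun k => x (k + 1) :=
    (Finset.measurable_restrict S).comp hP.measurable
  rw [blockEntropy_eq P hm]
  · conv_rhs => rw [blockEntropy, ← hP.map_eq]
    rw [Measure.map_map (Finset.measurable_restrict S) hP.measurable]
    rfl
  · intro x y
    rw [restrict_eq_iff]
    simp

theorem blockEntropy_shift {P : Measure (ℤ → A)} [IsProbabilityMeasure P] (hP : IsStationary P)
    (c : ℤ) (S : Finset ℤ) :
    blockEntropy P (S.map (addRightEmbedding c)) = blockEntropy P S := by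
  have hadd : ∀ a b : ℤ, (S.map (addRightEmbedding a)).map (addRightEmbedding b) =
      S.map (addRightEmbedding (a + b)) := by
    intro a b
    rw [Finset.map_map]
    congr 1
    ext x; simp [add_assoc]
  induction c using Int.induction_on with
  | zero => congr 1; ext x; simp
  | succ i ih => rw [← hadd, blockEntropy_shift_one hP, ih]
  | pred i ih =>
    rw [← blockEntropy_shift_one hP, hadd]
    simpa using ih

theorem isBlockEntropy_blockEntropy {P : Measure (ℤ → A)} [IsProbabilityMeasure P]
    (hP : IsStationary P) (hA : Fintype.card A = 2) : IsBlockEntropy (blockEntropy P) where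
  empty := by
    have hp : IsProbabilityMeasure (P.map (∅ : Finset ℤ).restrict) :=
      Measure.isProbabilityMeasure_map (Finset.measurable_restrict (X := fun _ => A) _).aemeasurable
    refine le_antisymm ?_ (entropy_nonneg _)
    have := entropy_le_log_card (P.map (∅ : Finset ℤ).restrict)
    simpa [blockEntropy] using this
  mono S T hST := entropy_le_of_factors P (Finset.measurable_restrict T) fun x y h => by
    rw [restrict_eq_iff] at h ⊢
    exact fun i hi => h i (hST hi)
  submodular S T := by
    have h := entropy_submodular P (Finset.measurable_restrict (X := fun _ => A) S)
      (Finset.measurable_restrict T) (Finset.measurable_restrict (S ∩ T))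
    have mS := Finset.measurable_restrict (X := fun _ : ℤ => A) S
    have mT := Finset.measurable_restrict (X := fun _ : ℤ => A) T
    have mI := Finset.measurable_restrict (X := fun _ : ℤ => A) (S ∩ T)
    -- The restrictions to S, T and S ∩ T jointly determine, and are determined by, the restriction
    -- to S ∪ T; likewise the pairs with S and with T.
    rw [← blockEntropy_eq P (S := S ∪ T) (mS.prodMk (mT.prodMk mI)),
      ← blockEntropy_eq P (S := S) (mS.prodMk mI),
      ← blockEntropy_eq P (S := T) (mT.prodMk mI)] at h
    · exact h
    all_goals
      intro x y
      simp only [Prod.mk.injEq, restrict_eq_iff]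
      grind
  shift := blockEntropy_shift hP
  singleton_le := by
    have hm : Measurable fun x : ℤ → A => x 1 := measurable_pi_apply 1
    have hp : IsProbabilityMeasure (P.map fun x : ℤ → A => x 1) :=
      Measure.isProbabilityMeasure_map hm.aemeasurable
    rw [blockEntropy_eq P hm fun x y => by simp]
    simpa [hA] using entropy_le_log_card (P.map fun x : ℤ → A => x 1)

end BlockEntropy

-- Block mutual information as a mean block entropy

section BlockInfo

variable {K : ℕ}

instance (ε : unitInterval) : IsProbabilityMeasure (erasureLaw ε) := by
  unfold erasureLaw; infer_instance

/-- The embedding `k ↦ k + 1` of `{0, …, n - 1}` into the times. -/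
def timeEmbedding (n : ℕ) : Fin n ↪ ℤ :=
  ⟨fun k => (k : ℕ) + 1, fun a b h => by simpa [Fin.ext_iff] using h⟩

theorem timeEmbedding_apply (n : ℕ) (k : Fin n) : timeEmbedding n k = (k : ℕ) + 1 := rfl

theorem map_timeEmbedding_univ (n : ℕ) :
    Finset.univ.map (timeEmbedding n) = Finset.Icc 1 (n : ℤ) := by
  ext x
  simp only [timeEmbedding_apply, Finset.mem_map, Finset.mem_univ, true_and, Finset.mem_Icc]
  constructor
  · rintro ⟨k, rfl⟩; omega
  · rintro ⟨h1, h2⟩; exact ⟨⟨(x - 1).toNat, by omega⟩, by simp only; omega⟩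

theorem bernoulli_real_singleton (ε : unitInterval) (a : Fin 2) :
    (ProbabilityTheory.bernoulliMeasure (0 : Fin 2) 1 ε).real {a} =
      if a = 1 then 1 - (ε : ℝ) else ε := by
  fin_cases a <;> simp

theorem erasureLaw_block (ε : unitInterval) (n : ℕ) (e : Fin n → Fin 2) :
    ((erasureLaw ε).map fun (η : ℤ → Fin 2) (k : Fin n) => η ((k : ℕ) + 1)).real {e} =
      (1 - (ε : ℝ)) ^ (Finset.univ.filter (e · = 1)).card *
        (ε : ℝ) ^ (Finset.univ \ Finset.univ.filter (e · = 1)).card := by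
  rw [map_measureReal_apply (by fun_prop) (measurableSet_singleton e)]
  let t : ℤ → Set (Fin 2) := fun i => {a | ∀ k : Fin n, timeEmbedding n k = i → a = e k}
  have hset : (fun (η : ℤ → Fin 2) (k : Fin n) => η ((k : ℕ) + 1)) ⁻¹' {e} =
      Set.pi (Finset.univ.map (timeEmbedding n) : Finset ℤ) t := by
    ext η
    simp only [Set.mem_preimage, Set.mem_singleton_iff, funext_iff, Set.mem_pi, Finset.mem_coe,
      Finset.mem_map, Finset.mem_univ, true_and, t, Set.mem_ofPred_eq]
    constructor
    · rintro h i - k rfl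
      exact h k
    · intro h k
      exact h _ ⟨k, rfl⟩ k rfl
  have ht : ∀ k, t (timeEmbedding n k) = {e k} := by
    intro k; ext a; simp [t]
  rw [hset, measureReal_def, erasureLaw, Measure.infinitePi_pi _ fun _ _ => Set.toFinite _ |>.measurableSet,
    Finset.prod_map, ENNReal.toReal_prod]
  simp_rw [ht]
  have : ∀ k, ((ProbabilityTheory.bernoulliMeasure (0 : Fin 2) 1 ε) {e k}).toReal =
      if e k = 1 then 1 - (ε : ℝ) else ε := fun k => bernoulli_real_singleton ε (e k)
  simp_rw [this]
  rw [Finset.prod_ite, Finset.prod_const, Finset.prod_const, Finset.filter_not]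

theorem output_inj {x x' : Input K} {e e' : Fin 2} (h : output x e = output x' e') : e = e' := by
  have hx := x.2
  have hx' := x'.2
  unfold output at h
  fin_cases e <;> fin_cases e' <;> simp_all

theorem output_eq_iff {x x' : Input K} {e : Fin 2} :
    output x e = output x' e ↔ (e = 1 → x = x') := by
  unfold output
  fin_cases e <;> simp [Subtype.ext_iff]

/-- Given the erasure pattern, the output is equivalent to the letters at the surviving times, so
its conditional entropy is a block entropy. -/
theorem blockInfo_eq (P : Measure (ℤ → Input K)) [IsProbabilityMeasure P] (ε : unitInterval)
    (n : ℕ) :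
    blockInfo P ε n = erasureMean (ε : ℝ) (Finset.Icc 1 (n : ℤ)) (blockEntropy P) := by
  set f : (ℤ → Input K) → Fin n → Input K := fun x k => x ((k : ℕ) + 1) with hfdef
  set g : (ℤ → Fin 2) → Fin n → Fin 2 := fun η k => η ((k : ℕ) + 1) with hgdef
  have hf : Measurable f := by fun_prop
  have hg : Measurable g := by fun_prop
  have hα : IsProbabilityMeasure (P.map f) := Measure.isProbabilityMeasure_map hf.aemeasurable
  have hβ : IsProbabilityMeasure ((erasureLaw ε).map g) :=
    Measure.isProbabilityMeasure_map hg.aemeasurable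
  let φ : (Fin n → Input K) → (Fin n → Fin 2) → Fin n → Output K := fun x e k => output (x k) (e k)
  have hprod : (P.map f).prod ((erasureLaw ε).map g) = (jointLaw P ε).map (Prod.map f g) :=
    Measure.map_prod_map _ _ hf hg
  have hfg : Measurable (Prod.map f g) := hf.prodMap hg
  have hX : (jointLaw P ε).map (inputBlock n) = P.map f := by
    have : inputBlock n = f ∘ Prod.fst := rfl
    rw [this, ← Measure.map_map hf measurable_fst, jointLaw, Measure.map_fst_prod]
    simp
  have hY : (jointLaw P ε).map (outputBlock n) =
      ((P.map f).prod ((erasureLaw ε).map g)).map fun z => φ z.1 z.2 := by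
    rw [hprod, Measure.map_map (measurable_of_finite _) hfg]; rfl
  have hXY : ((jointLaw P ε).map fun ω => (inputBlock n ω, outputBlock n ω)) =
      ((P.map f).prod ((erasureLaw ε).map g)).map fun z => (z.1, φ z.1 z.2) := by
    rw [hprod, Measure.map_map (measurable_of_finite _) hfg]; rfl
  rw [blockInfo, hX, hY, hXY, mutualInfo_eq_sum _ _ φ
    fun a a' b b' h => funext fun k => output_inj (congrFun h k),
    ← map_timeEmbedding_univ, erasureMean_map, erasureMean]
  -- Erasure patterns correspond to their sets of surviving positions, and `erasureLaw_block`
  -- matches the weights.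
  refine Finset.sum_nbij' (fun e => Finset.univ.filter (e · = 1)) (fun R k => if k ∈ R then 1 else 0)
    (by simp) (by simp) ?_ ?_ ?_
  · intro e _
    ext k
    have : e k = 0 ∨ e k = 1 := by omega
    rcases this with h | h <;> simp [h]
  · intro R _
    ext k; simp
  · intro e _
    rw [erasureLaw_block, Measure.map_map (measurable_of_finite _) hf]
    congr 1
    refine (blockEntropy_eq P ((measurable_of_finite _).comp hf) fun x y => ?_).symm
    simp only [Function.comp_apply, φ, funext_iff, output_eq_iff, Finset.mem_map, Finset.mem_filter,
      Finset.mem_univ, true_and, forall_exists_index, and_imp]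
    constructor
    · rintro h i k hk rfl
      exact h k hk
    · exact fun h k hk => h _ k hk rfl

end BlockInfo

-- Passing to the limit: bounds for the information rate

section Rate

variable {P : Measure (ℤ → Input 2)} {ε : unitInterval}

theorem card_input (K : ℕ) : Fintype.card (Input K) = K := by
  simp [Input, Fintype.card_subtype_compl]

theorem IsInput.isBlockEntropy {S : Set (List (Input 2))} (hP : IsInput S P) :
    IsBlockEntropy (blockEntropy P) :=
  have := hP.isProbabilityMeasure
  isBlockEntropy_blockEntropy hP.isStationary (card_input 2)

/-- Fekete's lemma: the block informations are subadditive in n and nonnegative. -/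
theorem IsInput.tendsto_infoRate {S : Set (List (Input 2))} (hP : IsInput S P) :
    Tendsto (fun n : ℕ => blockInfo P ε n / n) atTop (𝓝 (infoRate P ε)) := by
  have := hP.isProbabilityMeasure
  have hh := hP.isBlockEntropy
  have hsub := hh.subadditive ε.2.1 ε.2.2
  have hb : BddBelow (Set.range fun n : ℕ =>
      erasureMean (ε : ℝ) (Finset.Icc 1 (n : ℤ)) (blockEntropy P) / n) := by
    refine ⟨0, ?_⟩
    rintro _ ⟨n, rfl⟩
    exact div_nonneg (hh.erasureMean_nonneg ε.2.1 ε.2.2 _) n.cast_nonneg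
  refine tendsto_nhds_limUnder ⟨hsub.lim, ?_⟩
  simp_rw [blockInfo_eq]
  exact hsub.tendsto_lim hb

theorem IsInput.infoRate_le {S : Set (List (Input 2))} (hP : IsInput S P) :
    infoRate P ε ≤ erasureMean (ε : ℝ) (Finset.Icc 1 3) (blockEntropy P) -
      erasureMean (ε : ℝ) (Finset.Icc 1 2) (blockEntropy P) := by
  have := hP.isProbabilityMeasure
  have hh := hP.isBlockEntropy
  set J := erasureMean (ε : ℝ) (Finset.Icc 1 3) (blockEntropy P) -
      erasureMean (ε : ℝ) (Finset.Icc 1 2) (blockEntropy P) with hJ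
  set c := erasureMean (ε : ℝ) (Finset.Icc 1 2) (blockEntropy P) with hc
  have ht : Tendsto (fun n : ℕ => (c - 2 * J) / n + J) atTop (𝓝 (0 + J)) :=
    (tendsto_const_div_atTop_nhds_zero_nat _).add_const J
  rw [zero_add] at ht
  refine le_of_tendsto_of_tendsto hP.tendsto_infoRate ht ?_
  filter_upwards [eventually_ge_atTop 2] with n hn
  obtain ⟨m, rfl⟩ := Nat.exists_eq_add_of_le' hn
  have hpos : (0 : ℝ) < (m + 2 : ℕ) := by positivity
  rw [div_add' _ _ _ hpos.ne', div_le_div_iff_of_pos_right hpos, blockInfo_eq]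
  have := hh.erasureMean_add_two_le ε.2.1 ε.2.2 m
  rw [← hJ, ← hc] at this
  push_cast at *
  linarith

theorem IsInput.infoRate_le_log_two {S : Set (List (Input 2))} (hP : IsInput S P) :
    infoRate P ε ≤ Real.log 2 := by
  have := hP.isProbabilityMeasure
  have hh := hP.isBlockEntropy
  have h0 : 0 ≤ 1 - (ε : ℝ) := by linarith [ε.2.2]
  refine le_of_tendsto hP.tendsto_infoRate ?_
  filter_upwards [eventually_ge_atTop 1] with n hn
  have hpos : (0 : ℝ) < n := by exact_mod_cast hn
  rw [div_le_iff₀ hpos, blockInfo_eq]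
  have hb := (hh.subadditive ε.2.1 ε.2.2).apply_mul_add_le n 1 0
  have hz : erasureMean (ε : ℝ) (Finset.Icc 1 0) (blockEntropy P) = 0 := by
    rw [show Finset.Icc (1 : ℤ) 0 = ∅ by decide, erasureMean_empty, hh.empty]
  simp only [mul_one, add_zero, Nat.cast_one, Nat.cast_zero, hz, hh.erasureMean_one] at hb
  have : (1 - (ε : ℝ)) * blockEntropy P {1} ≤ Real.log 2 := by
    nlinarith [hh.singleton_le, hh.nonneg {1}, ε.2.1]
  nlinarith

/-- The boundary terms c and 2 log 2 disappear after division by n. -/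
theorem IsInput.le_infoRate {S : Set (List (Input 2))} (hP : IsInput S P) {l c : ℝ}
    (hl : ∀ n : ℕ, n * l - c ≤ blockEntropy P (Finset.Icc 1 (n : ℤ))) :
    l - (ε * (blockEntropy P {1, 2, 3} - blockEntropy P {1, 3}) + 2 * Real.log 2 * (ε : ℝ) ^ 2) ≤
      infoRate P ε := by
  have := hP.isProbabilityMeasure
  have hh := hP.isBlockEntropy
  set J := l - (ε * (blockEntropy P {1, 2, 3} - blockEntropy P {1, 3}) +
    2 * Real.log 2 * (ε : ℝ) ^ 2) with hJ
  have ht : Tendsto (fun n : ℕ => -(c + 2 * Real.log 2) / n + J) atTop (𝓝 (0 + J)) :=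
    (tendsto_const_div_atTop_nhds_zero_nat _).add_const J
  rw [zero_add] at ht
  refine le_of_tendsto_of_tendsto ht hP.tendsto_infoRate ?_
  filter_upwards [eventually_ge_atTop 1] with n hn
  have hpos : (0 : ℝ) < n := by exact_mod_cast hn
  rw [div_add' _ _ _ hpos.ne', div_le_div_iff_of_pos_right hpos, blockInfo_eq]
  have := hh.le_erasureMean ε.2.1 ε.2.2 n
  nlinarith [hl n]

end Rate

-- Laws of three consecutive letters under the constraint

section Triples

/-- The letter `1`. -/
def one : Input 2 := ⟨1, by decide⟩

/-- The letter `2`. -/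
def two : Input 2 := ⟨2, by decide⟩

theorem one_ne_two : one ≠ two := by decide

theorem eq_one_or_eq_two (a : Input 2) : a = one ∨ a = two := by revert a; decide

theorem sum_input {M : Type*} [AddCommMonoid M] (g : Input 2 → M) : ∑ a, g a = g one + g two := by
  have : (Finset.univ : Finset (Input 2)) = {one, two} := by decide
  rw [this, Finset.sum_pair one_ne_two]

theorem word_succ {A : Type*} (x : ℤ → A) (i : ℤ) (n : ℕ) :
    word x i (n + 1) = word x i n ++ [x (i + n)] := by
  simp [word, -List.ofFn_succ, List.ofFn_succ_last]

variable {P : Measure (ℤ → Input 2)}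

theorem IsInput.wordProb_two_two (hP : IsInput rll P) (i : ℤ) : wordProb P i [two, two] = 0 := by
  by_contra h
  have hpos : 0 < wordProb P i [two, two] := lt_of_le_of_ne measureReal_nonneg (Ne.symm h)
  exact hP.words_subset ⟨i, hpos⟩ _ rfl (List.infix_refl _)

theorem wordProb_singleton (i : ℤ) (a : Input 2) :
    wordProb P i [a] = P.real {x | x i = a} := by
  simp [wordProb, word]

theorem wordProb_pair (i : ℤ) (a b : Input 2) :
    wordProb P i [a, b] = P.real {x | x i = a ∧ x (i + 1) = b} := by
  simp [wordProb, word]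

theorem wordProb_triple (i : ℤ) (a b c : Input 2) :
    wordProb P i [a, b, c] = P.real {x | x i = a ∧ x (i + 1) = b ∧ x (i + 2) = c} := by
  simp [wordProb, word]

theorem IsStationary.real_preimage (hP : IsStationary P) {s : Set (ℤ → Input 2)}
    (hs : MeasurableSet s) : P.real {x | (fun k => x (k + 1)) ∈ s} = P.real s :=
  hP.measureReal_preimage hs.nullMeasurableSet

theorem measurableSet_word_eq (i : ℤ) (w : List (Input 2)) :
    MeasurableSet {x : ℤ → Input 2 | word x i w.length = w} := by
  have : {x : ℤ → Input 2 | word x i w.length = w} =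
      (fun (x : ℤ → Input 2) (k : Fin w.length) => x (i + (k : ℕ))) ⁻¹' {f | List.ofFn f = w} := rfl
  rw [this]
  exact (Set.toFinite _).measurableSet.preimage (by fun_prop)

theorem IsStationary.wordProb_succ (hP : IsStationary P) (i : ℤ) (w : List (Input 2)) :
    wordProb P (i + 1) w = wordProb P i w := by
  rw [wordProb, wordProb, ← hP.real_preimage (measurableSet_word_eq i w)]
  congr 1
  ext x
  have : word x (i + 1) w.length = word (fun k => x (k + 1)) i w.length := by
    unfold word
    congr 1
    ext k
    rw [add_right_comm]
  simp only [this, Set.mem_ofPred_eq]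

/-- The block entropies up to length three of an input process, in terms of the probabilities of
the words `2` and `212`. -/
theorem IsInput.triple_table (hP : IsInput rll P) {π s : ℝ} (hπ : wordProb P 1 [two] = π)
    (hs : wordProb P 1 [two, one, two] = s) :
    (wordProb P 1 [one] = 1 - π ∧ wordProb P 1 [one, two] = π ∧ wordProb P 1 [two, one] = π) ∧
    (0 ≤ s ∧ s ≤ π ∧ 0 ≤ 1 - 3 * π + s) ∧
    blockEntropy P {1} = Real.negMulLog (1 - π) + Real.negMulLog π ∧
    blockEntropy P {1, 2} = Real.negMulLog (1 - 2 * π) + 2 * Real.negMulLog π ∧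
    blockEntropy P {1, 3} =
      Real.negMulLog (1 - 2 * π + s) + 2 * Real.negMulLog (π - s) + Real.negMulLog s ∧
    blockEntropy P {1, 2, 3} = Real.negMulLog (1 - 3 * π + s) + 2 * Real.negMulLog (π - s) +
      Real.negMulLog π + Real.negMulLog s := by
  have := hP.isProbabilityMeasure
  set f : (ℤ → Input 2) → Input 2 × Input 2 × Input 2 := fun x => (x 1, x 2, x 3) with hf
  have hfm : Measurable f := by fun_prop
  set ν := P.map f with hν
  have hpν : IsProbabilityMeasure ν := Measure.isProbabilityMeasure_map hfm.aemeasurable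
  set m : Input 2 → Input 2 → Input 2 → ℝ := fun a b c => ν.real {(a, b, c)} with hm
  -- Every event in three letters is a sum of the eight masses m a b c. Total mass, the ban on 22,
  -- and stationarity between times 1, 2 and 2, 3 form a linear system that leaves only π and s
  -- free.
  have hset : ∀ Q : Input 2 → Input 2 → Input 2 → Prop, [∀ a b c, Decidable (Q a b c)] →
      P.real {x | Q (x 1) (x 2) (x 3)} =
        ∑ a, ∑ b, ∑ c, if Q a b c then m a b c else 0 := by
    intro Q _
    have h1 : P.real {x | Q (x 1) (x 2) (x 3)} = ν.real {t | Q t.1 t.2.1 t.2.2} := by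
      rw [hν, map_measureReal_apply hfm (Set.toFinite _).measurableSet]; rfl
    have h2 : {t : Input 2 × Input 2 × Input 2 | Q t.1 t.2.1 t.2.2} =
        ((Finset.univ.filter fun t : Input 2 × Input 2 × Input 2 => Q t.1 t.2.1 t.2.2 :
          Finset _) : Set _) := by ext; simp
    rw [h1, h2, ← sum_measureReal_singleton, Finset.sum_filter, Fintype.sum_prod_type]
    simp_rw [Fintype.sum_prod_type]
    rfl
  have hnn : ∀ a b c, 0 ≤ m a b c := fun _ _ _ => measureReal_nonneg
  have n12 := one_ne_two
  have n21 := one_ne_two.symm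
  have hst := hP.isStationary
  have hone : P.real {x : ℤ → Input 2 | True} = 1 := by simp
  have w1 : ∀ a, wordProb P 1 [a] = P.real {x | x 1 = a} := fun a => wordProb_singleton 1 a
  have w2 : ∀ a b, wordProb P 1 [a, b] = P.real {x | x 1 = a ∧ x 2 = b} := fun a b =>
    wordProb_pair 1 a b
  have w2' : ∀ a b, wordProb P 1 [a, b] = P.real {x | x 2 = a ∧ x 3 = b} := fun a b => by
    rw [← hst.wordProb_succ]; exact wordProb_pair 2 a b
  have w3 : wordProb P 1 [two, one, two] = P.real {x | x 1 = two ∧ x 2 = one ∧ x 3 = two} :=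
    wordProb_triple 1 _ _ _
  have z := hP.wordProb_two_two 1
  have z' := z
  have c11 := w2 one one
  have c11' := w2' one one
  have c12 := w2 one two
  have c12' := w2' one two
  have c21 := w2 two one
  have c21' := w2' two one
  have d1 := w1 one
  have d2 := w1 two
  rw [w2] at z
  rw [w2'] at z'
  rw [hs] at w3
  rw [hπ] at d2
  rw [hset fun _ _ _ => True] at hone
  rw [hset fun a b _ => a = two ∧ b = two] at z
  rw [hset fun _ b c => b = two ∧ c = two] at z'
  rw [hset fun a b _ => a = one ∧ b = one] at c11
  rw [hset fun _ b c => b = one ∧ c = one] at c11'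
  rw [hset fun a b _ => a = one ∧ b = two] at c12
  rw [hset fun _ b c => b = one ∧ c = two] at c12'
  rw [hset fun a b _ => a = two ∧ b = one] at c21
  rw [hset fun _ b c => b = two ∧ c = one] at c21'
  rw [hset fun a _ _ => a = one] at d1
  rw [hset fun a _ _ => a = two] at d2
  rw [hset fun a b c => a = two ∧ b = one ∧ c = two] at w3
  simp only [sum_input, n12, n21, and_true, and_false, if_true, if_false,
    add_zero, zero_add] at hone z z' c11 c11' c12 c12' c21 c21' d1 d2 w3
  have g1 := hnn two two one
  have g2 := hnn two two two
  have g3 := hnn one two two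
  have z1 : m two two one = 0 := by linarith
  have z2 : m two two two = 0 := by linarith
  have z3 : m one two two = 0 := by linarith
  have m212 : m two one two = s := w3.symm
  have m211 : m two one one = π - s := by linarith
  have m112 : m one one two = π - s := by linarith
  have m121 : m one two one = π := by linarith
  have m111 : m one one one = 1 - 3 * π + s := by linarith
  refine ⟨⟨by linarith, by linarith, by linarith⟩, ⟨m212 ▸ hnn _ _ _, ?_, m111 ▸ hnn _ _ _⟩,
    ?_, ?_, ?_, ?_⟩
  · linarith [hnn two one one]
  · have hg : Measurable fun x : ℤ → Input 2 => x 1 := by fun_prop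
    rw [blockEntropy_eq P hg fun x y => by simp, entropy, sum_input,
      map_measureReal_apply hg (measurableSet_singleton _),
      map_measureReal_apply hg (measurableSet_singleton _)]
    change Real.negMulLog (P.real {x | x 1 = one}) + Real.negMulLog (P.real {x | x 1 = two}) = _
    rw [hset fun a _ _ => a = one, hset fun a _ _ => a = two]
    simp only [sum_input, n12, n21, if_true, if_false, add_zero, zero_add, z1, z2, z3, m212, m211,
      m112, m121, m111]
    ring_nf
  · have hg : Measurable fun x : ℤ → Input 2 => (x 1, x 2) := by fun_prop
    have hr : ∀ a b, (P.map fun x : ℤ → Input 2 => (x 1, x 2)).real {(a, b)} =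
        P.real {x | x 1 = a ∧ x 2 = b} := fun a b => by
      rw [map_measureReal_apply hg (measurableSet_singleton _)]
      congr 1; ext x; simp
    rw [blockEntropy_eq P hg fun x y => by simp, entropy, Fintype.sum_prod_type]
    simp only [sum_input, hr]
    rw [hset fun a b _ => a = one ∧ b = one, hset fun a b _ => a = one ∧ b = two,
      hset fun a b _ => a = two ∧ b = one, hset fun a b _ => a = two ∧ b = two]
    simp only [sum_input, n12, n21, and_true, and_false, if_true, if_false,
      add_zero, zero_add, z1, z2, z3, m212, m211, m112, m121, m111, Real.negMulLog_zero]
    ring_nf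
  · have hg : Measurable fun x : ℤ → Input 2 => (x 1, x 3) := by fun_prop
    have hr : ∀ a b, (P.map fun x : ℤ → Input 2 => (x 1, x 3)).real {(a, b)} =
        P.real {x | x 1 = a ∧ x 3 = b} := fun a b => by
      rw [map_measureReal_apply hg (measurableSet_singleton _)]
      congr 1; ext x; simp
    rw [blockEntropy_eq P hg fun x y => by simp, entropy, Fintype.sum_prod_type]
    simp only [sum_input, hr]
    rw [hset fun a _ b => a = one ∧ b = one, hset fun a _ b => a = one ∧ b = two,
      hset fun a _ b => a = two ∧ b = one, hset fun a _ b => a = two ∧ b = two]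
    simp only [sum_input, n12, n21, and_true, and_false, if_true, if_false,
      add_zero, zero_add, z1, z2, z3, m212, m211, m112, m121, m111]
    ring_nf
  · rw [blockEntropy_eq P hfm fun x y => by simp [hf], entropy, Fintype.sum_prod_type]
    simp_rw [Fintype.sum_prod_type]
    change ∑ a, ∑ b, ∑ c, Real.negMulLog (m a b c) = _
    simp only [sum_input, z1, z2, z3, m212, m211, m112, m121, m111, Real.negMulLog_zero]
    ring

end Triples

-- Comparison with the golden-mean chain and the upper expansion

section Bounds

/-- Splitting a mass into two parts: comparison with the split in proportion `1 - r : r`. -/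
theorem negMulLog_split_le {x y r : ℝ} (hx : 0 ≤ x) (hy : 0 ≤ y) (hxy : x + y ≤ 1) (hr : 0 < r)
    (hr1 : r < 1) :
    Real.negMulLog x + Real.negMulLog y - Real.negMulLog (x + y) ≤
      -(x * Real.log (1 - r)) - y * Real.log r - (y - r * (x + y)) ^ 2 / 4 := by
  rcases (add_nonneg hx hy).eq_or_lt with h | h
  · have hx0 : x = 0 := by linarith
    have hy0 : y = 0 := by linarith
    simp [hx0, hy0]
  have hr' : 0 < 1 - r := by linarith
  have h1 := negMulLog_le_cross (p := x) (q := (1 - r) * (x + y)) hx (by positivity)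
    fun h0 => absurd h0 (by positivity)
  have h2 := negMulLog_le_cross_sub_sq (p := y) (q := r * (x + y)) hy (by linarith) (by positivity)
    (by nlinarith) fun h0 => absurd h0 (by positivity)
  rw [Real.log_mul hr'.ne' h.ne'] at h1
  rw [Real.log_mul hr.ne' h.ne'] at h2
  have h3 : Real.negMulLog (x + y) = -(x + y) * Real.log (x + y) := rfl
  rw [h3]
  nlinarith

open Real in
theorem golden_inv_facts : 0 < goldenRatio⁻¹ ∧ goldenRatio⁻¹ < 1 ∧
    goldenRatio⁻¹ ^ 2 = 1 - goldenRatio⁻¹ := by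
  have h0 := goldenRatio_pos
  have h1 := one_lt_goldenRatio
  refine ⟨by positivity, inv_lt_one_of_one_lt₀ h1, ?_⟩
  have := goldenRatio_sq
  generalize goldenRatio = φ at *
  field_simp
  linarith

/-- The probability of the letter `2` under the process of maximal entropy. -/
def goldenMass : ℝ := 1 / (1 + Real.goldenRatio ^ 2)

/-- With ψ = 1/λ, this is the stationarity equation π = (1 - π)ψ² of the chain that moves from 1 to
2 with probability ψ². -/
theorem goldenMass_mul : goldenMass * (1 + Real.goldenRatio⁻¹ ^ 2) = Real.goldenRatio⁻¹ ^ 2 := by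
  have h0 := Real.goldenRatio_pos
  unfold goldenMass
  field_simp
  ring

/-- Equivalent to 1 - 2π + s = 2π at π = `goldenMass`, s = πψ²: both neighbours of a letter are 1
with probability 2π. -/
theorem four_mul_goldenMass : 4 * goldenMass = 1 + goldenMass * Real.goldenRatio⁻¹ ^ 2 := by
  obtain ⟨h0, h1, h2⟩ := golden_inv_facts
  have h := goldenMass_mul
  have hp : 0 < 1 + Real.goldenRatio⁻¹ ^ 2 := by positivity
  refine mul_right_cancel₀ hp.ne' ?_
  calc 4 * goldenMass * (1 + Real.goldenRatio⁻¹ ^ 2)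
      = 4 * (goldenMass * (1 + Real.goldenRatio⁻¹ ^ 2)) := by ring
    _ = (1 + goldenMass * Real.goldenRatio⁻¹ ^ 2) * (1 + Real.goldenRatio⁻¹ ^ 2) := by
      rw [h]
      have : (1 + goldenMass * Real.goldenRatio⁻¹ ^ 2) * (1 + Real.goldenRatio⁻¹ ^ 2) =
        1 + Real.goldenRatio⁻¹ ^ 2 +
          (goldenMass * (1 + Real.goldenRatio⁻¹ ^ 2)) * Real.goldenRatio⁻¹ ^ 2 := by ring
      rw [this, h, h2]
      nlinarith

/-- Completing the square: the difference is controlled by 8ε²k², and k² ≤ 4. -/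
theorem quadratic_tradeoff {ε k x : ℝ} (hk : |k| ≤ 2) :
    ε * (k * x) - x ^ 2 / 32 ≤ 32 * ε ^ 2 := by
  have : k ^ 2 ≤ 4 := by nlinarith [abs_le.1 hk]
  nlinarith [sq_nonneg (x / 8 - 2 * ε * k), mul_le_mul_of_nonneg_left this (sq_nonneg ε)]

/-- A and B are the deviations from the optimal chain, w is the probability that both neighbours are
1, l stands for log 2 and M for `goldenMass`. For t ≤ 1/2 the quadratic loss is at least (A² +
B²)/32, which absorbs the linear terms. The constant is 67 = 2·32 + 2 + 1: two trade-offs, the error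
of replacing (1 - t)² by 1 - 2t, and the term t² l. -/
theorem perturbed_rate_le {t L l w A B k M : ℝ} (t0 : 0 ≤ t) (t2 : t ≤ 1 / 2) (hL : 0 ≤ L)
    (l0 : 0 < l) (l1 : l ≤ 1) (w0 : 0 ≤ w) (w1 : w ≤ 1) (k0 : 0 ≤ k) (k2 : k ≤ 2)
    (hlin : w = 2 * M - (k * A + (k - 1) * B)) :
    (1 - t) * ((1 - t) ^ 2 * (L - (A ^ 2 + B ^ 2) / 4) +
      t * (1 - t) * (L + (2 * L - l * w)) + t ^ 2 * l) ≤ L - 2 * l * M * t + 67 * t ^ 2 := by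
  have hcube : 1 / 8 ≤ (1 - t) ^ 3 := by
    calc (1 / 8 : ℝ) = (1 / 2) ^ 3 := by norm_num
      _ ≤ (1 - t) ^ 3 := by gcongr; linarith
  have q1 := quadratic_tradeoff (ε := t) (k := l * k) (x := A)
    (by rw [abs_of_nonneg (by positivity)]; nlinarith)
  have q2 := quadratic_tradeoff (ε := t) (k := l * (k - 1)) (x := B)
    (by rw [abs_mul, abs_of_pos l0]
        have : |k - 1| ≤ 1 := abs_le.2 ⟨by linarith, by linarith⟩
        nlinarith [abs_nonneg (k - 1)])
  have hsq : (1 / 8) * ((A ^ 2 + B ^ 2) / 4) ≤ (1 - t) ^ 3 * ((A ^ 2 + B ^ 2) / 4) := by gcongr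
  have hLt : ((1 - t) ^ 3 + 3 * (t * (1 - t) ^ 2)) * L ≤ 1 * L := by
    refine mul_le_mul_of_nonneg_right ?_ hL
    nlinarith [mul_nonneg (pow_nonneg t0 2) (by linarith : 0 ≤ 1 - t)]
  have hwt : t * (l * w) * (1 - 2 * t) ≤ t * (l * w) * (1 - t) ^ 2 := by
    refine mul_le_mul_of_nonneg_left ?_ (by positivity)
    nlinarith
  have hlw : l * w ≤ 1 := by nlinarith
  have hlw2 : t ^ 2 * (l * w) ≤ t ^ 2 * 1 := by gcongr
  have hlast : (1 - t) * (t ^ 2 * l) ≤ 1 * (t ^ 2 * 1) := by gcongr; linarith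
  have hfin : -(t * (l * w)) = -(2 * l * M * t) + t * (l * k * A) + t * (l * (k - 1) * B) := by
    rw [hlin]; ring
  have hexp : (1 - t) * ((1 - t) ^ 2 * (L - (A ^ 2 + B ^ 2) / 4) +
      t * (1 - t) * (L + (2 * L - l * w)) + t ^ 2 * l) =
      ((1 - t) ^ 3 + 3 * (t * (1 - t) ^ 2)) * L - (1 - t) ^ 3 * ((A ^ 2 + B ^ 2) / 4) -
        t * (l * w) * (1 - t) ^ 2 + (1 - t) * (t ^ 2 * l) := by ring
  rw [hexp]
  linarith

variable {P : Measure (ℤ → Input 2)} {ε : unitInterval}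

/-- Bounds for the conditional entropies by comparison with the process of maximal entropy. -/
theorem IsInput.blockEntropy_bounds (hP : IsInput rll P) {π s : ℝ} (hπ : wordProb P 1 [two] = π)
    (hs : wordProb P 1 [two, one, two] = s) {ψ L : ℝ} (g0 : 0 < ψ) (g1 : ψ < 1)
    (g2 : ψ ^ 2 = 1 - ψ) (hlog : Real.log ψ = -L) :
    blockEntropy P {1, 2, 3} - blockEntropy P {1, 2} ≤
      L - ((π - s - ψ ^ 2 * (1 - 2 * π)) ^ 2 + (s - ψ ^ 2 * π) ^ 2) / 4 ∧
    blockEntropy P {1, 2} - blockEntropy P {1} ≤ L ∧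
    blockEntropy P {1, 3} - blockEntropy P {1} ≤ 2 * L - Real.log 2 * (1 - 2 * π + s) := by
  obtain ⟨-, ⟨hs0, hsπ, hx0⟩, e1, e12, e13, e123⟩ := hP.triple_table hπ hs
  have hq1 : 1 - ψ ^ 2 = ψ := by linarith
  have hq2 : ψ ^ 2 < 1 := by linarith
  have l2 : Real.log (ψ ^ 2) = -(2 * L) := by rw [Real.log_pow, hlog]; push_cast; ring
  have l3 : Real.log (ψ ^ 3) = -(3 * L) := by rw [Real.log_pow, hlog]; push_cast; ring
  -- The reference two-step transitions from 1 are ψ·ψ² = ψ³ to 2 and ψ² + ψ² = 2ψ² to 1. The factor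
  -- 2 is the source of log 2 in the third bound.
  have hq3 : 1 - ψ ^ 3 = 2 * ψ ^ 2 := by
    have : ψ ^ 3 = ψ * ψ ^ 2 := by ring
    rw [this, g2, mul_sub, ← sq, g2]; ring
  have l4 : Real.log (1 - ψ ^ 3) = Real.log 2 - 2 * L := by
    rw [hq3, Real.log_mul two_ne_zero (by positivity), l2]; ring
  have hq3' : ψ ^ 3 < 1 := by linarith [pow_pos g0 2]
  -- Splits by the last letter: 11 into 111 and 112, 21 into 211 and 212, 1 into 11 and 12, and
  -- finally X_1 = 1 by the value of X_3.
  have a1 := negMulLog_split_le (x := 1 - 3 * π + s) (y := π - s) (r := ψ ^ 2) hx0 (by linarith)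
    (by linarith) (by positivity) hq2
  have a2 := negMulLog_split_le (x := π - s) (y := s) (r := ψ ^ 2) (by linarith) hs0
    (by linarith) (by positivity) hq2
  have b1 := negMulLog_split_le (x := 1 - 2 * π) (y := π) (r := ψ ^ 2) (by linarith) (by linarith)
    (by linarith) (by positivity) hq2
  have c1 := negMulLog_split_le (x := 1 - 2 * π + s) (y := π - s) (r := ψ ^ 3) (by linarith)
    (by linarith) (by linarith) (by positivity) hq3'
  rw [hq1, hlog, l2] at a1 a2 b1
  rw [l4, l3] at c1
  rw [show 1 - 3 * π + s + (π - s) = 1 - 2 * π by ring] at a1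
  rw [sub_add_cancel] at a2
  rw [show 1 - 2 * π + π = 1 - π by ring] at b1
  rw [show 1 - 2 * π + s + (π - s) = 1 - π by ring] at c1
  refine ⟨?_, ?_, ?_⟩
  · rw [e123, e12]; linarith
  · rw [e12, e1]; linarith [sq_nonneg (π - ψ ^ 2 * (1 - π))]
  · rw [e13, e1]
    linarith [sq_nonneg (π - s - ψ ^ 3 * (1 - π)), sq_nonneg (s - ψ ^ 2 * π)]

/-- The first order upper bound for the rates. -/
theorem IsInput.infoRate_le_expansion (hP : IsInput rll P) (hε : (ε : ℝ) ≤ 1 / 2) :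
    infoRate P ε ≤ Real.log Real.goldenRatio - 2 * Real.log 2 * goldenMass * ε +
      67 * (ε : ℝ) ^ 2 := by
  obtain ⟨π, hπ⟩ : ∃ π, wordProb P 1 [two] = π := ⟨_, rfl⟩
  obtain ⟨s, hs⟩ : ∃ s, wordProb P 1 [two, one, two] = s := ⟨_, rfl⟩
  obtain ⟨-, ⟨hs0, hsπ, hx0⟩, -⟩ := hP.triple_table hπ hs
  have hh := hP.isBlockEntropy
  have hrate := hP.infoRate_le (ε := ε)
  rw [hh.erasureMean_three_sub_two] at hrate
  obtain ⟨g0, g1, g2⟩ := golden_inv_facts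
  have hm := goldenMass_mul
  have hm4 := four_mul_goldenMass
  have hlog : Real.log Real.goldenRatio⁻¹ = -Real.log Real.goldenRatio := Real.log_inv _
  have hL0 : 0 ≤ Real.log Real.goldenRatio := Real.log_nonneg Real.one_lt_goldenRatio.le
  generalize Real.log Real.goldenRatio = L at *
  generalize Real.goldenRatio⁻¹ = ψ at *
  obtain ⟨ba, bb, bc⟩ := hP.blockEntropy_bounds hπ hs g0 g1 g2 hlog
  have h2pos : 0 < Real.log 2 := Real.log_pos (by norm_num)
  have h2le : Real.log 2 ≤ 1 := by linarith [Real.log_two_lt_d9]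
  have e0 : 0 ≤ (ε : ℝ) := ε.2.1
  generalize (ε : ℝ) = t at *
  have t1 : 0 ≤ 1 - t := by linarith
  have hq0 : 0 < ψ ^ 2 := by positivity
  -- This ratio k makes w - 2M linear in the deviations: A + B = (1 + ψ²)(π - M), and w - 2M = B -
  -- (2 - ψ²)(π - M).
  have hkm : (2 - ψ ^ 2) / (1 + ψ ^ 2) * (1 + ψ ^ 2) = 2 - ψ ^ 2 :=
    div_mul_cancel₀ _ (by positivity)
  have hk0 : 0 ≤ (2 - ψ ^ 2) / (1 + ψ ^ 2) := div_nonneg (by linarith) (by positivity)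
  have hk2 : (2 - ψ ^ 2) / (1 + ψ ^ 2) ≤ 2 := by
    rw [div_le_iff₀ (by positivity)]; linarith
  generalize (2 - ψ ^ 2) / (1 + ψ ^ 2) = k at *
  have hlin : 1 - 2 * π + s = 2 * goldenMass -
      (k * (π - s - ψ ^ 2 * (1 - 2 * π)) + (k - 1) * (s - ψ ^ 2 * π)) := by
    have hAB : π - s - ψ ^ 2 * (1 - 2 * π) + (s - ψ ^ 2 * π) =
      (1 + ψ ^ 2) * (π - goldenMass) := by linarith
    have : k * (π - s - ψ ^ 2 * (1 - 2 * π)) + (k - 1) * (s - ψ ^ 2 * π) =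
      k * (π - s - ψ ^ 2 * (1 - 2 * π) + (s - ψ ^ 2 * π)) - (s - ψ ^ 2 * π) := by ring
    rw [this, hAB, ← mul_assoc, hkm]
    linarith
  refine hrate.trans (le_trans ?_ (perturbed_rate_le e0 hε hL0 h2pos h2le
    (show 0 ≤ 1 - 2 * π + s by linarith) (by linarith) hk0 hk2 hlin))
  gcongr
  exact hh.singleton_le

/-- The conditional entropy of a letter given its neighbours. -/
theorem IsInput.blockEntropy_sub_le (hP : IsInput rll P) {π s : ℝ} (hπ : wordProb P 1 [two] = π)
    (hs : wordProb P 1 [two, one, two] = s) :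
    blockEntropy P {1, 2, 3} - blockEntropy P {1, 3} ≤ (1 - 2 * π + s) * Real.log 2 := by
  obtain ⟨-, ⟨hs0, hsπ, hx0⟩, -, -, e13, e123⟩ := hP.triple_table hπ hs
  -- Between two letters 1 the middle letter is compared with a fair coin; next to a 2 it is forced
  -- to be 1.
  have h := negMulLog_split_le (x := 1 - 3 * π + s) (y := π) (r := 1 / 2) hx0 (by linarith)
    (by linarith) (by norm_num) (by norm_num)
  rw [show (1 : ℝ) - 1 / 2 = 2⁻¹ by norm_num, one_div, Real.log_inv,
    show 1 - 3 * π + s + π = 1 - 2 * π + s by ring] at h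
  rw [e13, e123]
  nlinarith [sq_nonneg (π - 2⁻¹ * (1 - 2 * π + s))]

end Bounds

-- The chain of maximal entropy and the lower expansion

section MaxEntropy

/-- In the binary sequence `e`, exactly `r` consecutive zeros end at time `k`. -/
def ZeroRun (e : ℤ → Fin 2) (k : ℤ) (r : ℕ) : Prop :=
  (∀ j < r, e (k - (j : ℕ)) = 0) ∧ e (k - r) = 1

theorem ZeroRun.unique {e : ℤ → Fin 2} {k : ℤ} {r r' : ℕ} (h : ZeroRun e k r)
    (h' : ZeroRun e k r') : r = r' := by
  by_contra hne
  rcases Nat.lt_or_gt_of_ne hne with hlt | hlt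
  · have := (h'.1 r hlt).symm.trans h.2; simp at this
  · have := (h.1 r' hlt).symm.trans h'.2; simp at this

theorem ZeroRun.succ {e : ℤ → Fin 2} {k : ℤ} {r : ℕ} (h : ZeroRun e k r) (h0 : e (k + 1) = 0) :
    ZeroRun e (k + 1) (r + 1) := by
  refine ⟨fun j hj => ?_, ?_⟩
  · rcases j with _ | j
    · simpa using h0
    · have := h.1 j (by omega)
      rw [← this]; congr 1; push_cast; ring
  · rw [← h.2]; congr 1; push_cast; ring

theorem exists_zeroRun {e : ℤ → Fin 2} {k : ℤ} (h : ∃ r : ℕ, e (k - r) ≠ 0) :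
    ∃ r, ZeroRun e k r := by
  classical
  refine ⟨Nat.find h, fun j hj => not_not.1 (Nat.find_min h hj), ?_⟩
  have := Nat.find_spec h
  omega

open Classical in
/-- The two-sided chain driven by `e`: after a letter `1`, the next letter is `2` if `e` is `0`
and `1` otherwise; after a `2` it is `1`. Hence a letter is `2` iff the run of zeros of `e` that
ends there has odd length. -/
def chain (e : ℤ → Fin 2) (k : ℤ) : Input 2 :=
  if ∃ r, Odd r ∧ ZeroRun e k r then two else one

/-- The successor of the letter `b` in the chain. -/
def chainStep (b : Input 2) (u : Fin 2) : Input 2 := if b = one ∧ u = 0 then two else one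

theorem chain_eq_two_iff {e : ℤ → Fin 2} {k : ℤ} :
    chain e k = two ↔ ∃ r, Odd r ∧ ZeroRun e k r := by
  unfold chain
  split_ifs with h <;> simp [h, one_ne_two]

/-- Extending a finite run of zeros by one flips its parity, and a one resets it. The hypothesis
excludes an infinite run, for which `chain` takes the default letter 1 and the recursion can fail.
-/
theorem chain_succ {e : ℤ → Fin 2} {k : ℤ} (h : ∃ r : ℕ, e (k - r) ≠ 0) :
    chain e (k + 1) = chainStep (chain e k) (e (k + 1)) := by
  obtain ⟨r, hr⟩ := exists_zeroRun h
  have hk : chain e k = two ↔ Odd r := chain_eq_two_iff.trans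
    ⟨fun ⟨r', ho, h'⟩ => hr.unique h' ▸ ho, fun ho => ⟨r, ho, hr⟩⟩
  have h01 : e (k + 1) = 0 ∨ e (k + 1) = 1 := by omega
  rcases h01 with h0 | h1
  · have hk1 : chain e (k + 1) = two ↔ Odd (r + 1) := chain_eq_two_iff.trans
      ⟨fun ⟨r', ho, h'⟩ => (hr.succ h0).unique h' ▸ ho, fun ho => ⟨_, ho, hr.succ h0⟩⟩
    rw [Nat.odd_add_one, ← hk] at hk1
    rcases eq_one_or_eq_two (chain e k) with hc | hc <;>
      rcases eq_one_or_eq_two (chain e (k + 1)) with hd | hd <;>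
      simp_all [chainStep, one_ne_two, one_ne_two.symm]
  · have hz : ZeroRun e (k + 1) 0 := ⟨fun j hj => absurd hj (by omega), by simpa using h1⟩
    have : chain e (k + 1) ≠ two := fun h2 => by
      obtain ⟨r', ho, h'⟩ := chain_eq_two_iff.1 h2
      rw [← hz.unique h'] at ho
      simp at ho
    rw [(eq_one_or_eq_two _).resolve_right this]
    simp [chainStep, h1]

/-- Holds for every e: a letter 2 already witnesses a finite run, so the recursion applies. -/
theorem chain_not_two_two (e : ℤ → Fin 2) (k : ℤ) : ¬ (chain e k = two ∧ chain e (k + 1) = two) := by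
  rintro ⟨h, h'⟩
  obtain ⟨r, -, hr⟩ := chain_eq_two_iff.1 h
  rw [chain_succ ⟨r, by rw [hr.2]; simp⟩, h] at h'
  simp [chainStep, one_ne_two, one_ne_two.symm] at h'

theorem chain_shift (e : ℤ → Fin 2) (k : ℤ) : chain (fun j => e (j + 1)) k = chain e (k + 1) := by
  have : ∀ r, ZeroRun (fun j => e (j + 1)) k r ↔ ZeroRun e (k + 1) r := by
    intro r
    simp only [ZeroRun, sub_add_eq_add_sub]
  have h : chain (fun j => e (j + 1)) k = two ↔ chain e (k + 1) = two := by
    rw [chain_eq_two_iff, chain_eq_two_iff]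
    exact exists_congr fun r => and_congr_right fun _ => this r
  rcases eq_one_or_eq_two (chain (fun j => e (j + 1)) k) with h1 | h1 <;>
    rcases eq_one_or_eq_two (chain e (k + 1)) with h2 | h2 <;>
    simp_all [one_ne_two]

/-- The events that depend on the driving sequence up to time `k`. -/
abbrev pastSigma (k : ℤ) : MeasurableSpace (ℤ → Fin 2) :=
  ⨆ j ∈ Set.Iic k, MeasurableSpace.comap (fun e : ℤ → Fin 2 => e j) inferInstance

theorem pastSigma_mono {k l : ℤ} (h : k ≤ l) : pastSigma k ≤ pastSigma l :=
  biSup_mono fun _ hj => le_trans hj h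

theorem pastSigma_le (k : ℤ) : pastSigma k ≤ MeasurableSpace.pi :=
  iSup₂_le fun j _ => (measurable_pi_apply j).comap_le

theorem measurableSet_pastSigma_coord {j k : ℤ} (h : j ≤ k) (a : Fin 2) :
    MeasurableSet[pastSigma k] {e | e j = a} := by
  refine le_iSup₂_of_le (f := fun j (_ : j ∈ Set.Iic k) =>
    MeasurableSpace.comap (fun e : ℤ → Fin 2 => e j) inferInstance) j h le_rfl _ ?_
  exact ⟨{a}, measurableSet_singleton a, rfl⟩

theorem measurableSet_zeroRun (k : ℤ) (r : ℕ) :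
    MeasurableSet[pastSigma k] {e | ZeroRun e k r} := by
  have : {e | ZeroRun e k r} =
      (⋂ j : ℕ, ⋂ _ : j < r, {e : ℤ → Fin 2 | e (k - (j : ℕ)) = 0}) ∩ {e | e (k - r) = 1} := by
    ext e; simp [ZeroRun]
  rw [this]
  refine MeasurableSet.inter (MeasurableSet.iInter fun j => MeasurableSet.iInter fun _ => ?_) ?_
  · exact measurableSet_pastSigma_coord (by omega) 0
  · exact measurableSet_pastSigma_coord (by omega) 1

theorem measurableSet_chain_eq (k : ℤ) (a : Input 2) :
    MeasurableSet[pastSigma k] {e | chain e k = a} := by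
  have h2 : MeasurableSet[pastSigma k] {e | chain e k = two} := by
    have : {e | chain e k = two} = ⋃ r : ℕ, ⋃ _ : Odd r, {e | ZeroRun e k r} := by
      ext e; simp [chain_eq_two_iff]
    rw [this]
    exact MeasurableSet.iUnion fun r => MeasurableSet.iUnion fun _ => measurableSet_zeroRun k r
  rcases eq_one_or_eq_two a with rfl | rfl
  · have : {e | chain e k = one} = {e | chain e k = two}ᶜ := by
      ext e
      rcases eq_one_or_eq_two (chain e k) with h | h <;> simp [h, one_ne_two, one_ne_two.symm]
    rw [this]
    exact h2.compl
  · exact h2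

theorem measurable_chain : Measurable chain := by
  refine measurable_pi_lambda _ fun k => ?_
  exact measurable_to_countable' fun a => pastSigma_le k _ (measurableSet_chain_eq k a)

theorem word_eq_append_iff {A : Type*} {x : ℤ → A} {i : ℤ} {w : List A} {a : A} :
    word x i (w ++ [a]).length = w ++ [a] ↔ word x i w.length = w ∧ x (i + w.length) = a := by
  rw [List.length_append, List.length_singleton, word_succ]
  constructor
  · intro h
    have := List.append_inj h (by simp [word])
    simpa using this
  · rintro ⟨h1, h2⟩
    rw [h1, h2]

theorem measurableSet_word_chain (i : ℤ) (w : List (Input 2)) {k : ℤ} (hk : i + w.length ≤ k + 1) :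
    MeasurableSet[pastSigma k] {e | word (chain e) i w.length = w} := by
  induction w using List.reverseRecOn with
  | nil => simp [word]
  | append_singleton w a ih =>
    simp only [List.length_append, List.length_singleton, Nat.cast_add, Nat.cast_one] at hk
    have : {e | word (chain e) i (w ++ [a]).length = w ++ [a]} =
        {e | word (chain e) i w.length = w} ∩ {e | chain e (i + w.length) = a} := by
      ext e; exact word_eq_append_iff
    rw [this]
    exact (ih (by omega)).inter
      (pastSigma_mono (by omega) _ (measurableSet_chain_eq (i + w.length) a))

/-- The transition probability `1 → 2` of the chain of maximal entropy. -/
def goldenParam : unitInterval :=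
  ⟨Real.goldenRatio⁻¹ ^ 2, by positivity, by
    obtain ⟨h0, h1, h2⟩ := golden_inv_facts; rw [h2]; linarith⟩

/-- The law of the stationary chain of maximal entropy on the constraint. -/
def goldenLaw : Measure (ℤ → Input 2) := (erasureLaw goldenParam).map chain

instance : IsProbabilityMeasure goldenLaw :=
  Measure.isProbabilityMeasure_map measurable_chain.aemeasurable

theorem isStationary_erasureLaw (ε : unitInterval) : IsStationary (erasureLaw ε) := by
  refine ⟨by fun_prop, ?_⟩
  have h := Measure.infinitePi_map_piCongrLeft
    (fun _ : ℤ => ProbabilityTheory.bernoulliMeasure (0 : Fin 2) 1 ε) (Equiv.subRight (1 : ℤ))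
  have hfun : (fun (x : ℤ → Fin 2) (k : ℤ) => x (k + 1)) =
      MeasurableEquiv.piCongrLeft (fun _ => Fin 2) (Equiv.subRight (1 : ℤ)) := by
    ext x k
    rw [MeasurableEquiv.coe_piCongrLeft]
    have := Equiv.piCongrLeft_apply_apply (fun _ : ℤ => Fin 2) (Equiv.subRight (1 : ℤ)) x (k + 1)
    rw [Equiv.subRight_apply, add_sub_cancel_right] at this
    rw [this]
  rw [hfun]
  exact h

/-- The coding `chain` commutes with the shift, so it carries the stationarity of the i.i.d. driving
sequence over. -/
theorem isStationary_goldenLaw : IsStationary goldenLaw := by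
  refine ⟨by fun_prop, ?_⟩
  have h := (isStationary_erasureLaw goldenParam).map_eq
  unfold goldenLaw
  conv_rhs => rw [← h]
  rw [Measure.map_map (by fun_prop) measurable_chain,
    Measure.map_map measurable_chain (by fun_prop)]
  congr 1
  ext e k
  simp [chain_shift]

theorem wordProb_goldenLaw (i : ℤ) (w : List (Input 2)) :
    wordProb goldenLaw i w = (erasureLaw goldenParam).real {e | word (chain e) i w.length = w} := by
  rw [wordProb, goldenLaw, map_measureReal_apply measurable_chain
    (measurableSet_word_eq i w)]
  rfl

theorem isInput_goldenLaw : IsInput rll goldenLaw where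
  isProbabilityMeasure := inferInstance
  isStationary := isStationary_goldenLaw
  words_subset := by
    rintro w ⟨i, hw⟩ f rfl ⟨s, t, hst⟩
    rw [wordProb_goldenLaw] at hw
    obtain ⟨e, he⟩ := nonempty_of_measureReal_ne_zero hw.ne'
    rw [Set.mem_ofPred_eq] at he
    have hlen : w.length = s.length + 2 + t.length := by rw [← hst]; simp; omega
    have hget : ∀ k (hk : k < w.length), w[k] = chain e (i + k) := by
      intro k hk
      have : (word (chain e) i w.length)[k]'(by simpa [word] using hk) = chain e (i + k) := by
        simp [word]
      rw [← this]
      simp only [he]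
    have h1 := hget s.length (by omega)
    have h2 := hget (s.length + 1) (by omega)
    simp only [← hst] at h1 h2
    refine chain_not_two_two e (i + s.length) ⟨?_, ?_⟩
    · rw [← h1]; simp; rfl
    · have : i + (s.length : ℤ) + 1 = i + ((s.length + 1 : ℕ) : ℤ) := by push_cast; ring
      rw [this, ← h2]; simp; rfl

/-- N zeros in a row have probability ψ^(2N) with ψ² < 1, which tends to 0. -/
theorem ae_exists_ne_zero (k : ℤ) :
    ∀ᵐ e ∂erasureLaw goldenParam, ∃ r : ℕ, e (k - r) ≠ 0 := by
  obtain ⟨g0, g1, g2⟩ := golden_inv_facts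
  have hq : ∀ N : ℕ, (erasureLaw goldenParam).real {e | ¬ ∃ r : ℕ, e (k - r) ≠ 0} ≤
      (Real.goldenRatio⁻¹ ^ 2) ^ N := by
    intro N
    let emb : ℕ ↪ ℤ := ⟨fun r => k - r, fun a b h => by simpa using h⟩
    have hsub : {e : ℤ → Fin 2 | ¬ ∃ r : ℕ, e (k - r) ≠ 0} ⊆
        Set.pi ((Finset.range N).map emb : Finset ℤ) fun _ => {0} := by
      intro e he i hi
      obtain ⟨r, -, rfl⟩ := Finset.mem_map.1 (Finset.mem_coe.1 hi)
      simp only [Set.mem_ofPred_eq, not_exists, not_not] at he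
      exact he r
    refine (measureReal_mono hsub).trans (le_of_eq ?_)
    rw [measureReal_def, erasureLaw, Measure.infinitePi_pi _ fun _ _ => measurableSet_singleton _,
      ENNReal.toReal_prod]
    have : ((ProbabilityTheory.bernoulliMeasure (0 : Fin 2) 1 goldenParam) {0}).toReal =
        Real.goldenRatio⁻¹ ^ 2 := by
      simp [goldenParam]
    simp only [this, Finset.prod_const, Finset.card_map, Finset.card_range]
  have hlim : Tendsto (fun N : ℕ => (Real.goldenRatio⁻¹ ^ 2) ^ N) atTop (𝓝 0) :=
    tendsto_pow_atTop_nhds_zero_of_lt_one (by positivity) (by rw [g2]; linarith)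
  have h0 : (erasureLaw goldenParam).real {e | ¬ ∃ r : ℕ, e (k - r) ≠ 0} = 0 :=
    le_antisymm (ge_of_tendsto' hlim hq) measureReal_nonneg
  rw [ae_iff]
  exact (measureReal_eq_zero_iff).1 h0

/-- The transition matrix of the chain. -/
def chainKernel (b a : Input 2) : ℝ :=
  (ProbabilityTheory.bernoulliMeasure (0 : Fin 2) 1 goldenParam).real {u | chainStep b u = a}

theorem indep_past_future (k : ℤ) :
    ProbabilityTheory.Indep (pastSigma k)
      (MeasurableSpace.comap (fun e : ℤ → Fin 2 => e (k + 1)) inferInstance)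
      (erasureLaw goldenParam) := by
  have hind : ProbabilityTheory.iIndepFun (fun (j : ℤ) (e : ℤ → Fin 2) => e j)
      (erasureLaw goldenParam) :=
    ProbabilityTheory.iIndepFun_infinitePi (X := fun _ u => u) fun _ => measurable_id
  have h := ProbabilityTheory.indep_iSup_of_disjoint
    (fun j => (measurable_pi_apply (X := fun _ : ℤ => Fin 2) j).comap_le) hind.iIndep
    (S := Set.Iic k) (T := {k + 1}) (by simp)
  simpa [pastSigma] using h

/-- Up to a null set, the new letter is a function of b and the driving bit at time k + 1, which is
independent of the past that fixes w and b. -/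
theorem wordProb_goldenLaw_append (i : ℤ) (w : List (Input 2)) (b a : Input 2) :
    wordProb goldenLaw i (w ++ [b] ++ [a]) = wordProb goldenLaw i (w ++ [b]) * chainKernel b a := by
  set k : ℤ := i + w.length with hk
  rw [wordProb_goldenLaw, wordProb_goldenLaw]
  set S₁ := {e | word (chain e) i (w ++ [b]).length = w ++ [b]} with hS₁
  set S₂ := {e : ℤ → Fin 2 | chainStep b (e (k + 1)) = a} with hS₂
  have hae : {e | word (chain e) i (w ++ [b] ++ [a]).length = w ++ [b] ++ [a]}
      =ᵐ[erasureLaw goldenParam] (S₁ ∩ S₂ : Set (ℤ → Fin 2)) := by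
    filter_upwards [ae_exists_ne_zero k] with e he
    have hstep := chain_succ he
    refine propext ?_
    change word (chain e) i (w ++ [b] ++ [a]).length = w ++ [b] ++ [a] ↔
      word (chain e) i (w ++ [b]).length = w ++ [b] ∧ chainStep b (e (k + 1)) = a
    rw [word_eq_append_iff]
    refine and_congr_right fun h => ?_
    have hb : chain e k = b := (word_eq_append_iff.1 h).2
    have hpos : i + ((w ++ [b]).length : ℤ) = k + 1 := by
      rw [hk, List.length_append, List.length_singleton]; push_cast; ring
    rw [hpos, hstep, hb]
  have hm₁ : MeasurableSet[pastSigma k] S₁ := measurableSet_word_chain i (w ++ [b]) (by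
    rw [hk, List.length_append, List.length_singleton]; push_cast; omega)
  have hm₂ : MeasurableSet[MeasurableSpace.comap (fun e : ℤ → Fin 2 => e (k + 1)) inferInstance]
      S₂ := ⟨{u | chainStep b u = a}, (Set.toFinite _).measurableSet, rfl⟩
  have hS₂real : (erasureLaw goldenParam).real S₂ = chainKernel b a := by
    have := Measure.infinitePi_map_eval
      (fun _ : ℤ => ProbabilityTheory.bernoulliMeasure (0 : Fin 2) 1 goldenParam) (k + 1)
    rw [chainKernel, ← this, map_measureReal_apply (measurable_pi_apply _)
      (Set.toFinite _).measurableSet]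
    rfl
  rw [measureReal_congr hae, ← hS₂real, measureReal_def, measureReal_def, measureReal_def,
    ← ENNReal.toReal_mul]
  congr 1
  exact (ProbabilityTheory.Indep_iff _ _ _).1 (indep_past_future k) S₁ S₂ hm₁ hm₂

theorem isMarkov_goldenLaw {m : ℕ} (hm : 1 ≤ m) : IsMarkov m goldenLaw := by
  intro i u v a hv
  -- Since m ≥ 1, the conditioning word has a last letter b, and both sides of the Markov identity
  -- acquire the same factor `chainKernel b a`.
  obtain ⟨v, b, rfl⟩ : ∃ v' b, v = v' ++ [b] :=
    (List.eq_nil_or_concat' v).resolve_left (by rintro rfl; simp at hv; omega)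
  have h1 := wordProb_goldenLaw_append i (u ++ v) b a
  have h2 := wordProb_goldenLaw_append (i + u.length) v b a
  rw [← List.append_assoc, h1, h2]
  ring

theorem chainKernel_one_two : chainKernel one two = Real.goldenRatio⁻¹ ^ 2 := by
  have : {u | chainStep one u = two} = {(0 : Fin 2)} := by
    ext u; simp [chainStep, one_ne_two]
  rw [chainKernel, this, bernoulli_real_singleton]
  simp [goldenParam]

theorem chainKernel_one_one : chainKernel one one = Real.goldenRatio⁻¹ := by
  have : {u | chainStep one u = one} = {(1 : Fin 2)} := by
    ext u
    have : u = 0 ∨ u = 1 := by omega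
    rcases this with rfl | rfl <;> simp [chainStep, one_ne_two.symm]
  rw [chainKernel, this, bernoulli_real_singleton]
  obtain ⟨g0, g1, g2⟩ := golden_inv_facts
  simp only [if_true, goldenParam]
  linarith

theorem chainKernel_two_one : chainKernel two one = 1 := by
  have : {u | chainStep two u = one} = Set.univ := by
    ext u; simp [chainStep, one_ne_two.symm]
  rw [chainKernel, this, probReal_univ]

theorem chainKernel_two_two : chainKernel two two = 0 := by
  have : {u | chainStep two u = two} = ∅ := by
    ext u; simp [chainStep, one_ne_two, one_ne_two.symm]
  rw [chainKernel, this, measureReal_empty]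

/-- The weights that bound the word probabilities by the last letter. -/
def lastWeight (a : Input 2) : ℝ := if a = one then Real.goldenRatio else 1

theorem lastWeight_le (a : Input 2) : lastWeight a ≤ Real.goldenRatio := by
  unfold lastWeight
  split_ifs
  · exact le_rfl
  · exact Real.one_lt_goldenRatio.le

/-- Equality holds for the three allowed transitions: the kernel is 1/λ times a ratio of weights.
Word probabilities therefore telescope and are nearly uniform, which is why the entropy is maximal.
-/
theorem lastWeight_mul_chainKernel_le (b a : Input 2) :
    lastWeight b * chainKernel b a ≤ Real.goldenRatio⁻¹ * lastWeight a := by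
  have h0 := Real.goldenRatio_pos
  rcases eq_one_or_eq_two a with rfl | rfl <;> rcases eq_one_or_eq_two b with rfl | rfl <;>
    simp only [lastWeight, chainKernel_one_one, chainKernel_one_two, chainKernel_two_one,
      chainKernel_two_two, if_true, one_ne_two.symm, if_false]
  · rw [mul_comm]
  · rw [inv_mul_cancel₀ h0.ne', one_mul]
  · rw [sq, ← mul_assoc, mul_inv_cancel₀ h0.ne', one_mul, mul_one]
  · rw [mul_zero]; positivity

theorem wordProb_goldenLaw_le (i : ℤ) (w : List (Input 2)) (b : Input 2) :
    wordProb goldenLaw i (w ++ [b]) ≤ Real.goldenRatio⁻¹ ^ w.length * lastWeight b := by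
  have h0 := Real.goldenRatio_pos
  induction w using List.reverseRecOn generalizing b with
  | nil =>
    have : wordProb goldenLaw i [b] ≤ 1 := measureReal_le_one
    simp only [List.nil_append, List.length_nil, pow_zero, one_mul]
    refine this.trans ?_
    unfold lastWeight
    split_ifs
    · exact Real.one_lt_goldenRatio.le
    · exact le_rfl
  | append_singleton w c ih =>
    rw [wordProb_goldenLaw_append]
    calc _ ≤ Real.goldenRatio⁻¹ ^ w.length * lastWeight c * chainKernel c b := by
          gcongr
          · exact measureReal_nonneg
          · exact ih c
      _ = Real.goldenRatio⁻¹ ^ w.length * (lastWeight c * chainKernel c b) := by ring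
      _ ≤ Real.goldenRatio⁻¹ ^ w.length * (Real.goldenRatio⁻¹ * lastWeight b) := by
          have := lastWeight_mul_chainKernel_le c b
          gcongr
      _ = _ := by
          rw [List.length_append, List.length_singleton]; ring

theorem le_blockEntropy_goldenLaw (n : ℕ) :
    n * Real.log Real.goldenRatio - 2 * Real.log Real.goldenRatio ≤
      blockEntropy goldenLaw (Finset.Icc 1 (n : ℤ)) := by
  have hL : 0 ≤ Real.log Real.goldenRatio := Real.log_nonneg Real.one_lt_goldenRatio.le
  have h0 := Real.goldenRatio_pos
  rcases n with _ | n
  · have := isInput_goldenLaw.isBlockEntropy.nonneg (Finset.Icc 1 ((0 : ℕ) : ℤ))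
    refine le_trans ?_ this
    simp only [Nat.cast_zero]; linarith
  set f : (ℤ → Input 2) → Fin (n + 1) → Input 2 := fun x k => x (1 + (k : ℕ)) with hf
  have hfm : Measurable f := by fun_prop
  have hp : IsProbabilityMeasure (goldenLaw.map f) :=
    Measure.isProbabilityMeasure_map hfm.aemeasurable
  have hbl : blockEntropy goldenLaw (Finset.Icc 1 ((n + 1 : ℕ) : ℤ)) =
      entropy (goldenLaw.map f) := by
    refine blockEntropy_eq goldenLaw hfm fun x y => ?_
    simp only [hf, funext_iff, ← map_timeEmbedding_univ, Finset.mem_map, Finset.mem_univ, true_and,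
      forall_exists_index, forall_apply_eq_imp_iff, timeEmbedding_apply, add_comm (1 : ℤ)]
  have hprob : ∀ t, (goldenLaw.map f).real {t} ≤ Real.goldenRatio⁻¹ ^ n * Real.goldenRatio := by
    intro t
    have hw : (goldenLaw.map f).real {t} = wordProb goldenLaw 1 (List.ofFn t) := by
      rw [map_measureReal_apply hfm (measurableSet_singleton t), wordProb, List.length_ofFn]
      congr 1
      ext x
      simp [word, hf, -List.ofFn_succ]
    rw [hw, List.ofFn_succ_last]
    refine (wordProb_goldenLaw_le _ _ _).trans ?_
    rw [List.length_ofFn]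
    gcongr
    exact lastWeight_le _
  have hsum : ∑ t, (goldenLaw.map f).real {t} = 1 := by simp [sum_measureReal_singleton]
  rw [hbl, entropy]
  -- A word of n + 1 letters has probability at most λ^(-(n-1)), so its surprisal is at least (n -
  -- 1) log λ = (n + 1) log λ - 2 log λ.
  calc _ = ∑ t, (goldenLaw.map f).real {t} * ((n - 1) * Real.log Real.goldenRatio) := by
        rw [← Finset.sum_mul, hsum]; push_cast; ring
    _ ≤ _ := by
      refine Finset.sum_le_sum fun t _ => ?_
      rcases (measureReal_nonneg : 0 ≤ (goldenLaw.map f).real {t}).eq_or_lt with h | h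
      · simp [← h]
      · have hlog := Real.log_le_log h (hprob t)
        rw [Real.log_mul (by positivity) h0.ne', Real.log_pow, Real.log_inv] at hlog
        rw [Real.negMulLog, neg_mul, ← mul_neg]
        gcongr
        linarith

theorem goldenLaw_lower (ε : unitInterval) :
    Real.log Real.goldenRatio - 2 * Real.log 2 * goldenMass * ε - 2 * (ε : ℝ) ^ 2 ≤
      infoRate goldenLaw ε := by
  obtain ⟨π, hπ⟩ : ∃ π, wordProb goldenLaw 1 [two] = π := ⟨_, rfl⟩
  obtain ⟨s, hs⟩ : ∃ s, wordProb goldenLaw 1 [two, one, two] = s := ⟨_, rfl⟩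
  obtain ⟨⟨h1, h12, h21⟩, -⟩ := isInput_goldenLaw.triple_table hπ hs
  -- The two transitions yield π = (1 - π)ψ² and s = πψ², which identify π with `goldenMass`.
  have k12 := wordProb_goldenLaw_append 1 [] one two
  have k212 := wordProb_goldenLaw_append 1 [two] one two
  simp only [List.nil_append, List.cons_append, chainKernel_one_two, h1, h12, h21, hs] at k12 k212
  have hm := goldenMass_mul
  have hm4 := four_mul_goldenMass
  have hpos : 0 < 1 + Real.goldenRatio⁻¹ ^ 2 := by positivity
  have hπm : π = goldenMass := by
    refine mul_right_cancel₀ hpos.ne' ?_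
    rw [hm]; linarith
  have hF := isInput_goldenLaw.blockEntropy_sub_le hπ hs
  have hlow := isInput_goldenLaw.le_infoRate (ε := ε) le_blockEntropy_goldenLaw
  have hw : 1 - 2 * π + s = 2 * goldenMass := by rw [k212, hπm]; linarith
  rw [hw] at hF
  have e0 : 0 ≤ (ε : ℝ) := ε.2.1
  have h2 : Real.log 2 ≤ 1 := by linarith [Real.log_two_lt_d9]
  have t1 := mul_le_mul_of_nonneg_left hF e0
  have t2 := mul_le_mul_of_nonneg_right h2 (sq_nonneg (ε : ℝ))
  linarith

end MaxEntropy

-- Suprema of rates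

section Capacity

theorem golden_mem_markovRates {m : ℕ} (hm : 1 ≤ m) (ε : unitInterval) :
    infoRate goldenLaw ε ∈ markovRates m rll ε :=
  ⟨goldenLaw, isInput_goldenLaw, isMarkov_goldenLaw hm, rfl⟩

theorem golden_mem_rates (ε : unitInterval) : infoRate goldenLaw ε ∈ rates rll ε :=
  ⟨goldenLaw, isInput_goldenLaw, rfl⟩

theorem markovRates_subset_rates (m : ℕ) (ε : unitInterval) :
    markovRates m rll ε ⊆ rates rll ε := by
  rintro r ⟨P, hP, -, rfl⟩
  exact ⟨P, hP, rfl⟩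

theorem bddAbove_rates (ε : unitInterval) : BddAbove (rates rll ε) := by
  refine ⟨Real.log 2, ?_⟩
  rintro r ⟨P, hP, rfl⟩
  exact hP.infoRate_le_log_two

/-- The supremum of any set of rates that contains the rate of the chain of maximal entropy has
the first order expansion. -/
theorem sSup_isBigO {R : unitInterval → Set ℝ} (hsub : ∀ ε, R ε ⊆ rates rll ε)
    (hmem : ∀ ε, infoRate goldenLaw ε ∈ R ε) :
    (fun ε : unitInterval => sSup (R ε) - (Real.log Real.goldenRatio -
      2 * Real.log 2 / (1 + Real.goldenRatio ^ 2) * (ε : ℝ))) =O[𝓝 0]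
      fun ε : unitInterval => (ε : ℝ) ^ 2 := by
  refine IsBigO.of_bound 67 ?_
  have hev : ∀ᶠ ε : unitInterval in 𝓝 0, (ε : ℝ) < 1 / 2 :=
    (continuous_subtype_val.tendsto (0 : unitInterval)).eventually
      (gt_mem_nhds (by norm_num))
  filter_upwards [hev] with ε hε
  have hcoef : 2 * Real.log 2 / (1 + Real.goldenRatio ^ 2) = 2 * Real.log 2 * goldenMass := by
    rw [goldenMass]; ring
  have hup : sSup (R ε) ≤ Real.log Real.goldenRatio - 2 * Real.log 2 * goldenMass * ε +
      67 * (ε : ℝ) ^ 2 := by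
    refine csSup_le ⟨_, hmem ε⟩ fun r hr => ?_
    obtain ⟨P, hP, rfl⟩ := hsub ε hr
    exact hP.infoRate_le_expansion hε.le
  have hlow : infoRate goldenLaw ε ≤ sSup (R ε) :=
    le_csSup ((bddAbove_rates ε).mono (hsub ε)) (hmem ε)
  have := goldenLaw_lower ε
  rw [hcoef, Real.norm_eq_abs, Real.norm_eq_abs, abs_of_nonneg (sq_nonneg (ε : ℝ)), abs_le]
  constructor <;> nlinarith [sq_nonneg (ε : ℝ)]

end Capacity

end

end ErasureChannel

/-- The first three parts say that the quantities are well defined: the limits that define the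
mutual information rates exist, and the capacities are suprema of nonempty bounded sets. The last
two parts are the expansions as `ε → 0` within `[0, 1]`. -/
theorem mainTheorem9 :
    (∀ (ε : unitInterval) (P : Measure (ℤ → ErasureChannel.Input 2)),
      ErasureChannel.IsInput ErasureChannel.rll P →
        Tendsto (fun n : ℕ => ErasureChannel.blockInfo P ε n / n) atTop
          (𝓝 (ErasureChannel.infoRate P ε))) ∧
    (∀ ε : unitInterval,
      (ErasureChannel.rates ErasureChannel.rll ε).Nonempty ∧
        IsLUB (ErasureChannel.rates ErasureChannel.rll ε)
          (ErasureChannel.capacity ErasureChannel.rll ε)) ∧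
    (∀ n : ℕ, 1 ≤ n → ∀ ε : unitInterval,
      (ErasureChannel.markovRates n ErasureChannel.rll ε).Nonempty ∧
        IsLUB (ErasureChannel.markovRates n ErasureChannel.rll ε)
          (ErasureChannel.markovCapacity n ErasureChannel.rll ε)) ∧
    ((fun ε : unitInterval =>
        ErasureChannel.capacity ErasureChannel.rll ε -
          (Real.log Real.goldenRatio -
            2 * Real.log 2 / (1 + Real.goldenRatio ^ 2) * (ε : ℝ)))
      =O[𝓝 0] fun ε : unitInterval => (ε : ℝ) ^ 2) ∧
    (∀ n : ℕ, 1 ≤ n →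
      (fun ε : unitInterval =>
        ErasureChannel.markovCapacity n ErasureChannel.rll ε -
          (Real.log Real.goldenRatio -
            2 * Real.log 2 / (1 + Real.goldenRatio ^ 2) * (ε : ℝ)))
      =O[𝓝 0] fun ε : unitInterval => (ε : ℝ) ^ 2) := by
  refine ⟨fun ε P hP => hP.tendsto_infoRate, fun ε => ?_, fun n hn ε => ?_, ?_, fun n hn => ?_⟩
  · exact ⟨⟨_, ErasureChannel.golden_mem_rates ε⟩,
      isLUB_csSup ⟨_, ErasureChannel.golden_mem_rates ε⟩ (ErasureChannel.bddAbove_rates ε)⟩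
  · exact ⟨⟨_, ErasureChannel.golden_mem_markovRates hn ε⟩,
      isLUB_csSup ⟨_, ErasureChannel.golden_mem_markovRates hn ε⟩
        ((ErasureChannel.bddAbove_rates ε).mono (ErasureChannel.markovRates_subset_rates n ε))⟩
  · exact ErasureChannel.sSup_isBigO (fun _ => subset_rfl) ErasureChannel.golden_mem_rates
  · exact ErasureChannel.sSup_isBigO (ErasureChannel.markovRates_subset_rates n)
      (ErasureChannel.golden_mem_markovRates hn)
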